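/- Let $\Phi$ be a reduced, irreducible, crystallographic root system in a finite-dimensional $\mathbb{Q}$-vector space $E$ with Weyl group $W$, let $\Pi=\{\alpha_i\mid i\in I\}$ be a set of simple roots, $\Phi^+$ the corresponding set of positive roots, and $s_i\in W$ the reflection in $\alpha_i$; for $v\in E$ and $\alpha\in\Phi$ let $(v,\alpha^\vee)=2(v,\alpha)/(\alpha,\alpha)$. Let $\Lambda$ be the weight lattice, i.e. the set of all $v\in E$ with $(v,\alpha_i^\vee)\in\mathbb{Z}$ for all $i\in I$. A dominant weight $0\neq\lambda\in\Lambda$ is called minuscule if $(\lambda,\alpha^\vee)\in\{0,\pm1\}$ for all $\alpha\in\Phi$. Let $\Psi\subseteq\Lambda$ be a non-empty union of $W$-orbits of minuscule weights. Let $R$ be a commutative ring with $1$ and $\bar M$ a free $R$-module with basis $\{\bar z_\mu\mid\mu\in\Psi\}$. For $i\in I$ let $\bar e_i,\bar f_i\colon\bar M\to\bar M$ be the $R$-linear maps such that $\bar e_i(\bar z_\mu)=\bar z_{\mu+\alpha_i}$ if $(\mu,\alpha_i^\vee)=-1$ and $\bar e_i(\bar z_\mu)=0$ otherwise, and $\bar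 f_i(\bar z_\mu)=\bar z_{\mu-\alpha_i}$ if $(\mu,\alpha_i^\vee)=1$ and $\bar f_i(\bar z_\mu)=0$ otherwise. For $t\in R$ put $x_i(t)=\mathrm{id}+t\bar e_i$ and $y_i(t)=\mathrm{id}+t\bar f_i$; let $\bar n_i=x_i(1)y_i(-1)x_i(1)$ and $G=\langle x_i(t),y_i(t)\mid i\in I,\ t\in R\rangle\subseteq\mathrm{GL}(\bar M)$. For each $\alpha\in\Phi$ choose $i,i_1,\dots,i_k\in I$ such that $\alpha=s_{i_1}\cdots s_{i_k}(\alpha_i)$ and set $$\bar{\mathbf e}_\alpha=\bar n_{i_1}\cdots\bar n_{i_k}\,\bar e_i\,\bar n_{i_k}^{-1}\cdots\bar n_{i_1}^{-1},\qquad x_\alpha(t)=\mathrm{id}+t\bar{\mathbf e}_\alpha\ (t\in R),\qquad X_\alpha=\{x_\alpha(t)\mid t\in R\}.$$ Let $U^+=\langle x_\alpha(t)\mid\alpha\in\Phi^+,\ t\in R\rangle$. Then $X_\alpha\subseteq G$ for all $\alpha\in\Phi$, and, for every choice made above, the following hold. (a) $U^+=\prod_{\alpha\in\Phi^+}X_\alpha$,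 where the product of subsets is taken in any fixed order of $\Phi^+$. (b) Let $i\in I$ and $U_i^+=\langle X_\alpha\mid\alpha\in\Phi^+,\ \alpha\neq\alpha_i\rangle$. Then $U_i^+$ is a normal subgroup of $U^+$ and $U^+=X_{\alpha_i}U_i^+$; furthermore, $\bar n_iX_{\alpha_i}\bar n_i^{-1}=X_{-\alpha_i}$ and $\bar n_iU_i^+\bar n_i^{-1}=U_i^+$. -/

import Mathlib

open scoped Pointwise

/-!
Setting: `P` is a crystallographic root pairing over `ℚ` on `E` (the roots live in `E`), and `b` is
a base of `P`, so that the simple roots are the `P.root i` for `i : b.support`.  For a vector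
`v : E` and a root `α = P.root i` the number `(v, α^∨)` is `P.coroot' i v`; for every
Weyl-invariant inner product on `E` it equals `2 (v, α) / (α, α)`.
-/

namespace MinusculeChevalley

noncomputable section

section Weights

variable {ι E F : Type*} [AddCommGroup E] [Module ℚ E] [AddCommGroup F] [Module ℚ F]
  {P : RootPairing ι ℚ E F}

/-- The weight lattice: all `v` with `(v, α_i^∨) ∈ ℤ` for every simple root `α_i`.  For a root
system this is the `ℤ`-span of the basis dual to the simple coroots. -/
def weightLattice (b : P.Base) : Set E :=
  {v | ∀ i : b.support, ∃ n : ℤ, P.coroot' i v = n}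

/-- A non-zero dominant weight `v` is minuscule if `(v, α^∨) ∈ {0, 1, -1}` for all roots `α`. -/
structure IsMinuscule (b : P.Base) (v : E) : Prop where
  mem_weightLattice : v ∈ weightLattice b
  ne_zero : v ≠ 0
  dominant : ∀ i : b.support, 0 ≤ P.coroot' i v
  coroot_eq : ∀ i : ι, P.coroot' i v = 0 ∨ P.coroot' i v = 1 ∨ P.coroot' i v = -1

/-- `Ψ` is a non-empty union of Weyl group orbits of minuscule weights. -/
structure IsMinusculeUnion (b : P.Base) (Ψ : Set E) : Prop where
  nonempty : Ψ.Nonempty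
  eq_iUnion_orbit : ∃ S : Set E, (∀ v ∈ S, IsMinuscule b v) ∧
    Ψ = ⋃ v ∈ S, MulAction.orbit P.weylGroup v

theorem IsMinusculeUnion.reflection_mem {b : P.Base} {Ψ : Set E} (hΨ : IsMinusculeUnion b Ψ)
    (i : ι) {v : E} (hv : v ∈ Ψ) : P.reflection i v ∈ Ψ := by
  obtain ⟨S, -, rfl⟩ := hΨ.eq_iUnion_orbit
  simp only [Set.mem_iUnion] at hv ⊢
  obtain ⟨s, hs, hv⟩ := hv
  refine ⟨s, hs, ?_⟩
  have h := MulAction.mem_orbit_of_mem_orbit (RootPairing.weylGroup.ofIdx P i) hv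
  simpa using h

theorem IsMinusculeUnion.add_mem {b : P.Base} {Ψ : Set E} (hΨ : IsMinusculeUnion b Ψ)
    (i : ι) {v : E} (hv : v ∈ Ψ) (h : P.coroot' i v = -1) : v + P.root i ∈ Ψ := by
  have := hΨ.reflection_mem i hv
  rwa [RootPairing.reflection_apply, h, neg_one_smul, sub_neg_eq_add] at this

theorem IsMinusculeUnion.sub_mem {b : P.Base} {Ψ : Set E} (hΨ : IsMinusculeUnion b Ψ)
    (i : ι) {v : E} (hv : v ∈ Ψ) (h : P.coroot' i v = 1) : v - P.root i ∈ Ψ := by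
  have := hΨ.reflection_mem i hv
  rwa [RootPairing.reflection_apply, h, one_smul] at this

/-- An expression `α = s_{i₁} ⋯ s_{iₖ}(α_i)` of the root `α` with index `a`:
`word = [i₁, …, iₖ]` and `node = i`, all of them indices of simple roots. -/
structure RootWord (b : P.Base) (a : ι) where
  word : List b.support
  node : b.support
  root_eq : P.root a = word.foldr (fun (j : b.support) v => P.reflection j v) (P.root node)

/-- Every root has such an expression. -/
theorem RootWord.nonempty [Finite ι] [P.IsCrystallographic] [P.IsReduced] (b : P.Base) (a : ι) :
    Nonempty (RootWord b a) := by
  refine b.induction_reflect a (p := fun a => Nonempty (RootWord b a)) ?_ ?_ ?_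
  · rintro i ⟨⟨w, k, h⟩⟩
    refine ⟨⟨w ++ [k], k, ?_⟩⟩
    have key : ∀ l : List b.support, ∀ v : E, l.foldr (fun (j : b.support) v => P.reflection j v) (-v) =
        -l.foldr (fun (j : b.support) v => P.reflection j v) v := by
      intro l v
      induction l with
      | nil => rfl
      | cons j l ih => simp only [List.foldr_cons, ih, map_neg]
    rw [RootPairing.root_reflectionPerm, RootPairing.reflection_apply_self, h, List.foldr_append]
    simp only [List.foldr_cons, List.foldr_nil, RootPairing.reflection_apply_self, key]
  · intro i hi
    exact ⟨⟨[], ⟨i, hi⟩, rfl⟩⟩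
  · rintro i j ⟨⟨w, k, h⟩⟩ hj
    refine ⟨⟨⟨j, hj⟩ :: w, k, ?_⟩⟩
    rw [RootPairing.root_reflectionPerm, h, List.foldr_cons]

/-- The index of the root `-α`, where `a` is the index of `α`. -/
def negIdx (P : RootPairing ι ℚ E F) (a : ι) : ι := P.reflectionPerm a a

theorem root_negIdx (a : ι) : P.root (negIdx P a) = -P.root a := by
  rw [negIdx, RootPairing.root_reflectionPerm, RootPairing.reflection_apply_self]

end Weights

section Unipotent

variable {R M : Type*} [CommRing R] [AddCommGroup M] [Module R M]

/-- The element `id + t e` of `GL(M)`, where `e ^ 2 = 0`; its inverse is `id - t e`. -/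
def unip (e : Module.End R M) (he : e * e = 0) (t : R) : LinearMap.GeneralLinearGroup R M where
  val := 1 + t • e
  inv := 1 - t • e
  val_inv := by
    simp [add_mul, mul_sub, he]
  inv_val := by
    simp [mul_add, sub_mul, he]

end Unipotent

section Group

variable {ι E F : Type*} [AddCommGroup E] [Module ℚ E] [AddCommGroup F] [Module ℚ F]
  {P : RootPairing ι ℚ E F} {b : P.Base} {Ψ : Set E}
  {R M : Type*} [CommRing R] [AddCommGroup M] [Module R M]

/-- The linear map `e_i` on the free module with basis `z_μ`, `μ ∈ Ψ`:
`z_μ ↦ z_{μ + α_i}` if `(μ, α_i^∨) = -1`, and `z_μ ↦ 0` otherwise. -/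
def eMap (hΨ : IsMinusculeUnion b Ψ) (z : Module.Basis Ψ R M) (i : b.support) : Module.End R M :=
  open Classical in
  z.constr R fun μ : Ψ =>
    if h : P.coroot' i (μ : E) = -1 then z ⟨μ + P.root i, hΨ.add_mem i μ.2 h⟩ else 0

/-- The linear map `f_i` on the free module with basis `z_μ`, `μ ∈ Ψ`:
`z_μ ↦ z_{μ - α_i}` if `(μ, α_i^∨) = 1`, and `z_μ ↦ 0` otherwise. -/
def fMap (hΨ : IsMinusculeUnion b Ψ) (z : Module.Basis Ψ R M) (i : b.support) : Module.End R M :=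
  open Classical in
  z.constr R fun μ : Ψ =>
    if h : P.coroot' i (μ : E) = 1 then z ⟨μ - P.root i, hΨ.sub_mem i μ.2 h⟩ else 0

theorem eMap_mul_self (hΨ : IsMinusculeUnion b Ψ) (z : Module.Basis Ψ R M) (i : b.support) :
    eMap hΨ z i * eMap hΨ z i = 0 := by
  refine z.ext fun μ => ?_
  rw [Module.End.mul_apply, LinearMap.zero_apply, eMap, Module.Basis.constr_basis]
  split_ifs with h
  · rw [Module.Basis.constr_basis, dif_neg]
    rw [map_add, h, RootPairing.root_coroot'_eq_pairing, RootPairing.pairing_same]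
    norm_num
  · simp

theorem fMap_mul_self (hΨ : IsMinusculeUnion b Ψ) (z : Module.Basis Ψ R M) (i : b.support) :
    fMap hΨ z i * fMap hΨ z i = 0 := by
  refine z.ext fun μ => ?_
  rw [Module.End.mul_apply, LinearMap.zero_apply, fMap, Module.Basis.constr_basis]
  split_ifs with h
  · rw [Module.Basis.constr_basis, dif_neg]
    rw [map_sub, h, RootPairing.root_coroot'_eq_pairing, RootPairing.pairing_same]
    norm_num
  · simp

/-- `x_i(t) = id + t e_i`. -/
def xSimple (hΨ : IsMinusculeUnion b Ψ) (z : Module.Basis Ψ R M) (i : b.support) (t : R) :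
    LinearMap.GeneralLinearGroup R M :=
  unip (eMap hΨ z i) (eMap_mul_self hΨ z i) t

/-- `y_i(t) = id + t f_i`. -/
def ySimple (hΨ : IsMinusculeUnion b Ψ) (z : Module.Basis Ψ R M) (i : b.support) (t : R) :
    LinearMap.GeneralLinearGroup R M :=
  unip (fMap hΨ z i) (fMap_mul_self hΨ z i) t

/-- The Chevalley group `G_R(Ψ)`, generated by all `x_i(t)` and `y_i(t)` in `GL(M)`. -/
def chevalleyGroup (hΨ : IsMinusculeUnion b Ψ) (z : Module.Basis Ψ R M) :
    Subgroup (LinearMap.GeneralLinearGroup R M) :=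
  Subgroup.closure ({g | ∃ (i : b.support) (t : R), g = xSimple hΨ z i t} ∪
    {g | ∃ (i : b.support) (t : R), g = ySimple hΨ z i t})

/-- `n_i(t) = x_i(t) y_i(-t⁻¹) x_i(t)` for a unit `t`. -/
def nElt (hΨ : IsMinusculeUnion b Ψ) (z : Module.Basis Ψ R M) (i : b.support) (t : Rˣ) :
    LinearMap.GeneralLinearGroup R M :=
  xSimple hΨ z i t * ySimple hΨ z i (-(t⁻¹ : Rˣ)) * xSimple hΨ z i t

/-- The product `n_{i₁} ⋯ n_{iₖ}`, where `n_i = n_i(1)` and `w = [i₁, …, iₖ]`. -/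
def nWord (hΨ : IsMinusculeUnion b Ψ) (z : Module.Basis Ψ R M) (w : List b.support) :
    LinearMap.GeneralLinearGroup R M :=
  (w.map fun i => nElt hΨ z i 1).prod

/-- The root vector `e_α = n_{i₁} ⋯ n_{iₖ} e_i n_{iₖ}⁻¹ ⋯ n_{i₁}⁻¹` attached to a choice `c` of
expressions `α = s_{i₁} ⋯ s_{iₖ}(α_i)` of all roots `α`; here `a` is the index of `α`. -/
def rootVec (hΨ : IsMinusculeUnion b Ψ) (z : Module.Basis Ψ R M) (c : ∀ a, RootWord b a) (a : ι) :
    Module.End R M :=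
  (nWord hΨ z (c a).word : Module.End R M) * eMap hΨ z (c a).node *
    ((nWord hΨ z (c a).word)⁻¹ : LinearMap.GeneralLinearGroup R M)

theorem rootVec_mul_self (hΨ : IsMinusculeUnion b Ψ) (z : Module.Basis Ψ R M)
    (c : ∀ a, RootWord b a) (a : ι) : rootVec hΨ z c a * rootVec hΨ z c a = 0 := by
  have h := eMap_mul_self hΨ z (c a).node
  simp only [rootVec, mul_assoc, Units.inv_mul_cancel_left]
  rw [← mul_assoc (eMap hΨ z (c a).node), h, zero_mul, mul_zero]

/-- `x_α(t) = id + t e_α`. -/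
def xRoot (hΨ : IsMinusculeUnion b Ψ) (z : Module.Basis Ψ R M) (c : ∀ a, RootWord b a) (a : ι)
    (t : R) : LinearMap.GeneralLinearGroup R M :=
  unip (rootVec hΨ z c a) (rootVec_mul_self hΨ z c a) t

/-- The root subgroup `X_α = {x_α(t) | t ∈ R}`, as a subset of `GL(M)`. -/
def rootSubgroup (hΨ : IsMinusculeUnion b Ψ) (z : Module.Basis Ψ R M) (c : ∀ a, RootWord b a)
    (a : ι) : Set (LinearMap.GeneralLinearGroup R M) :=
  Set.range (xRoot hΨ z c a)

/-- `U⁺`, generated by all `x_α(t)` with `α` a positive root and `t ∈ R`. -/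
def uPlus (hΨ : IsMinusculeUnion b Ψ) (z : Module.Basis Ψ R M) (c : ∀ a, RootWord b a) :
    Subgroup (LinearMap.GeneralLinearGroup R M) :=
  Subgroup.closure {g | ∃ (a : ι) (t : R), b.IsPos a ∧ g = xRoot hΨ z c a t}

/-- `U_i⁺`, generated by all `X_α` with `α` a positive root different from `α_i`. -/
def uPlusMinus (hΨ : IsMinusculeUnion b Ψ) (z : Module.Basis Ψ R M) (c : ∀ a, RootWord b a)
    (i : b.support) : Subgroup (LinearMap.GeneralLinearGroup R M) :=
  Subgroup.closure (⋃ (a : ι) (_ : b.IsPos a ∧ a ≠ i), rootSubgroup hΨ z c a)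

end Group

end

end MinusculeChevalley

/-! Everything reduces to Chevalley's commutator relations: for roots $\alpha\neq-\beta$, a
commutator of elements of $X_\alpha$ and $X_\beta$ is a product of elements of $X_\gamma$ with
$\gamma\in\{\alpha+\beta,\ 2\alpha+\beta,\ \alpha+2\beta\}$ (`commutator_xRoot_mem`). For positive
$\alpha,\beta$ such $\gamma$ have larger height. Pure group theory (`heightSubgroup_eq_prod`) then
gives (a), and the same filtration argument with two levels gives the normality in (b).

The relations need two facts. First, $\bar{\mathbf e}_\alpha\bar{\mathbf e}_\beta-\bar{\mathbf
e}_\beta\bar{\mathbf e}_\alpha$ and $\bar{\mathbf e}_\alpha\bar{\mathbf e}_\beta\bar{\mathbf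
e}_\alpha$ must be zero or integer multiples of a root vector. Over $\mathbb{Q}$ they lie in the
space `lieSpace` spanned by iterated brackets of the $e_i$, iterated brackets of the $f_i$, and
diagonal operators. This space is stable under conjugation by $G$, and $n_i$ moves its weights by
$s_i$. A weight vector of non-zero weight can therefore be conjugated to a weight where the spanning
set is explicit: it vanishes if the weight is not a root (`eq_zero_of_notMem_range_root`), and is a
multiple of the root vector otherwise. All these operators have integer matrices and $e_i$ has
entries 0 and 1, so the multiple is an integer (`exists_eq_smul_rootVec`), and the identity passes
from $\mathbb{Z}$ to any $R$ by base change. Conjugates $\bar n_i\bar{\mathbf e}_\alpha\bar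
n_i^{-1}$ are treated in the same way.

Second, at least one of $\bar{\mathbf e}_\alpha\bar{\mathbf e}_\beta\bar{\mathbf e}_\alpha$ and
$\bar{\mathbf e}_\beta\bar{\mathbf e}_\alpha\bar{\mathbf e}_\beta$ vanishes
(`rootVec_mul_mul_eq_zero_or`). The commutator then factors into two terms. -/

open scoped commutatorElement

namespace MinusculeChevalley

noncomputable section

/-! ### Groups filtered by height, and products of subgroups in arbitrary order. -/

section GroupTheory

variable {G ι : Type*} [Group G]

/-- The subgroup generated by the `X c` with `p c` and `h ≤ ht c`. -/
def heightSubgroup (X : ι → Subgroup G) (p : ι → Prop) (ht : ι → ℕ) (h : ℕ) : Subgroup G :=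
  ⨆ (c : ι) (_ : p c ∧ h ≤ ht c), X c

variable {X : ι → Subgroup G} {p : ι → Prop} {ht : ι → ℕ}

theorem mem_heightSubgroup {h : ℕ} {c : ι} (hc : p c) (hh : h ≤ ht c) {x : G} (hx : x ∈ X c) :
    x ∈ heightSubgroup X p ht h :=
  (le_iSup₂ (f := fun (c : ι) (_ : p c ∧ h ≤ ht c) => X c) c ⟨hc, hh⟩) hx

theorem heightSubgroup_anti {h k : ℕ} (hk : h ≤ k) :
    heightSubgroup X p ht k ≤ heightSubgroup X p ht h :=
  iSup₂_le fun _ hc _ hx => mem_heightSubgroup hc.1 (hk.trans hc.2) hx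

theorem heightSubgroup_induction {h : ℕ}
    {motive : ∀ u : G, u ∈ heightSubgroup X p ht h → Prop}
    (mem : ∀ c (hc : p c) (hh : h ≤ ht c) x (hx : x ∈ X c),
      motive x (mem_heightSubgroup hc hh hx))
    (one : motive 1 (one_mem _))
    (mul : ∀ x y (hx : x ∈ heightSubgroup X p ht h) (hy : y ∈ heightSubgroup X p ht h),
      motive x hx → motive y hy → motive (x * y) (mul_mem hx hy))
    {u : G} (hu : u ∈ heightSubgroup X p ht h) : motive u hu := by
  have hu' := hu
  unfold heightSubgroup at hu'
  have key : ∃ hu : u ∈ heightSubgroup X p ht h, motive u hu := by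
    refine Subgroup.iSup_induction _ (C := fun u => ∃ hu : u ∈ heightSubgroup X p ht h,
      motive u hu) hu' (fun c x hx => ?_) ⟨one_mem _, one⟩
      fun x y ⟨hx, hx'⟩ ⟨hy, hy'⟩ => ⟨mul_mem hx hy, mul x y hx hy hx' hy'⟩
    by_cases hc : p c ∧ h ≤ ht c
    · simp only [hc, and_self, iSup_pos] at hx
      exact ⟨mem_heightSubgroup hc.1 hc.2 hx, mem c hc.1 hc.2 x hx⟩
    · simp only [hc, iSup_false, Subgroup.mem_bot] at hx
      subst hx
      exact ⟨one_mem _, one⟩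
  exact key.2

/-- Since $xyx^{-1}=[x,y]\,y$, a level that absorbs commutators with every `X a` is normalised by
the whole group. -/
theorem conj_mem_heightSubgroup {h : ℕ}
    (hcomm : ∀ a b, p a → p b → h ≤ ht b → ∀ x ∈ X a, ∀ y ∈ X b,
      ⁅x, y⁆ ∈ heightSubgroup X p ht h)
    {u v : G} (hu : u ∈ heightSubgroup X p ht 0)
    (hv : v ∈ heightSubgroup X p ht h) : u * v * u⁻¹ ∈ heightSubgroup X p ht h := by
  induction hu using heightSubgroup_induction generalizing v with
  | mem a ha _ x hx =>
    induction hv using heightSubgroup_induction with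
    | mem b hb hhb y hy =>
      have h2 := mul_mem (hcomm a b ha hb hhb x hx y hy) (mem_heightSubgroup hb hhb hy)
      rwa [commutatorElement_def, inv_mul_cancel_right] at h2
    | one => simp
    | mul y z _ _ hy hz =>
      have := mul_mem hy hz
      rwa [show x * y * x⁻¹ * (x * z * x⁻¹) = x * (y * z) * x⁻¹ by group] at this
  | one => simpa using hv
  | mul x y _ _ hx hy =>
    have := hx (hy hv)
    rwa [show x * (y * v * y⁻¹) * x⁻¹ = x * y * v * (x * y)⁻¹ by group] at this

variable (hcomm : ∀ a b, p a → p b → ∀ x ∈ X a, ∀ y ∈ X b,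
  ⁅x, y⁆ ∈ heightSubgroup X p ht (ht b + 1))

include hcomm in
theorem commutator_mem_of_le {h : ℕ} {a b : ι} (ha : p a) (hb : p b) (hh : h ≤ ht b + 1)
    {x y : G} (hx : x ∈ X a) (hy : y ∈ X b) : ⁅x, y⁆ ∈ heightSubgroup X p ht h :=
  heightSubgroup_anti hh (hcomm a b ha hb x hx y hy)

-- $[uv,y]=u[v,y]u^{-1}\cdot[u,y]$, and every level is normalised by the whole group.
include hcomm in
theorem commutator_mem_heightSubgroup {u y : G} (hu : u ∈ heightSubgroup X p ht 0) {b : ι}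
    (hb : p b) (hy : y ∈ X b) : ⁅u, y⁆ ∈ heightSubgroup X p ht (ht b + 1) := by
  induction hu using heightSubgroup_induction with
  | mem a ha _ x hx => exact hcomm a b ha hb x hx y hy
  | one => simp
  | mul u v hu hv hu' hv' =>
    have := mul_mem (conj_mem_heightSubgroup (fun a b' ha hb' hh x hx y hy =>
      commutator_mem_of_le hcomm ha hb' (hh.trans (Nat.le_succ _)) hx hy) hu hv') hu'
    simp only [commutatorElement_def] at this ⊢
    rwa [show u * (v * y * v⁻¹ * y⁻¹) * u⁻¹ * (u * y * u⁻¹ * y⁻¹) =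
      u * v * y * (u * v)⁻¹ * y⁻¹ by group] at this

theorem prod_subset_heightSubgroup {l : List ι} (hl : ∀ a ∈ l, p a) {x : G}
    (hx : x ∈ (l.map fun a => (X a : Set G)).prod) : x ∈ heightSubgroup X p ht 0 := by
  induction l generalizing x with
  | nil =>
    rw [List.map_nil, List.prod_nil, Set.mem_one] at hx
    exact hx ▸ one_mem _
  | cons a t ih =>
    rw [List.map_cons, List.prod_cons] at hx
    obtain ⟨y, hy, z, hz, rfl⟩ := hx
    exact mul_mem (mem_heightSubgroup (hl a (by simp)) (Nat.zero_le _) hy)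
      (ih (fun a ha => hl a (by simp [ha])) hz)

theorem one_mem_prod (l : List ι) : (1 : G) ∈ (l.map fun a => (X a : Set G)).prod := by
  induction l with
  | nil => simp
  | cons a t ih =>
    rw [List.map_cons, List.prod_cons]
    exact ⟨1, one_mem (X a), 1, ih, mul_one 1⟩

-- Pull `y` leftwards through the tail `x₂` until it reaches the factor `X b`:
-- $x_2y=y\,x_2\,[x_2^{-1},y^{-1}]$, and the error term lies above level `ht b`.
include hcomm in
theorem exists_insert_mem_prod {l : List ι} (hl : ∀ a ∈ l, p a) {b : ι} (hb : b ∈ l) {x y : G}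
    (hx : x ∈ (l.map fun a => (X a : Set G)).prod) (hy : y ∈ X b) :
    ∃ x' ∈ (l.map fun a => (X a : Set G)).prod, ∃ v ∈ heightSubgroup X p ht (ht b + 1),
      x * y = x' * v := by
  induction l generalizing x with
  | nil => simp at hb
  | cons a t ih =>
    have ht' : ∀ a ∈ t, p a := fun a ha => hl a (by simp [ha])
    rw [List.map_cons, List.prod_cons] at hx ⊢
    obtain ⟨x₁, hx₁, x₂, hx₂, rfl⟩ := hx
    by_cases hab : b = a
    · subst hab
      refine ⟨x₁ * y * x₂, ⟨x₁ * y, mul_mem hx₁ hy, x₂, hx₂, rfl⟩, ⁅x₂⁻¹, y⁻¹⁆,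
        commutator_mem_heightSubgroup hcomm (inv_mem (prod_subset_heightSubgroup ht' hx₂))
          (hl b hb) (inv_mem hy), ?_⟩
      simp only [commutatorElement_def]
      group
    · obtain ⟨x', hx', v, hv, h⟩ := ih ht' ((List.mem_cons.mp hb).resolve_left hab) hx₂
      exact ⟨x₁ * x', ⟨x₁, hx₁, x', hx', rfl⟩, v, hv, by
        simp only [mul_assoc, h]⟩

include hcomm in
/-- If the commutators of the subgroups `X a` lie in the subgroup generated by those of larger
height, then the group generated by all of them is their product in any order. -/
theorem heightSubgroup_eq_prod (l : List ι) (hl : ∀ a, a ∈ l ↔ p a) :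
    (heightSubgroup X p ht 0 : Set G) = (l.map fun a => (X a : Set G)).prod := by
  have hl' : ∀ a ∈ l, p a := fun a => (hl a).1
  refine Set.Subset.antisymm (fun u hu => ?_) fun x hx => prod_subset_heightSubgroup hl' hx
  -- The error `v` is pushed to ever higher levels, one generator at a time.
  have key : ∀ h : ℕ, ∃ x ∈ (l.map fun a => (X a : Set G)).prod,
      ∃ v ∈ heightSubgroup X p ht h, u = x * v := by
    intro h
    induction h with
    | zero => exact ⟨1, one_mem_prod l, u, hu, (one_mul u).symm⟩
    | succ h ih =>
      obtain ⟨x, hx, v, hv, rfl⟩ := ih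
      clear hu
      induction hv using heightSubgroup_induction generalizing x with
      | mem b hb hhb y hy =>
        obtain hlt | heq := hhb.lt_or_eq
        · exact ⟨x, hx, y, mem_heightSubgroup hb hlt hy, rfl⟩
        · exact heq ▸ exists_insert_mem_prod hcomm hl' ((hl b).2 hb) hx hy
      | one => exact ⟨x, hx, 1, one_mem _, rfl⟩
      | mul v w hv hw ihv ihw =>
        obtain ⟨x', hx', v', hv', h'⟩ := ihv x hx
        obtain ⟨x'', hx'', v'', hv'', h''⟩ := ihw x' hx'
        -- $xvw=x'v'w=(x'w)(w^{-1}v'w)$, and conjugation by `w` preserves the level of `v'`.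
        refine ⟨x'', hx'', v'' * (w⁻¹ * v' * w), mul_mem hv'' ?_, ?_⟩
        · simpa using conj_mem_heightSubgroup (fun a b' ha hb' hh x hx y hy =>
            commutator_mem_of_le hcomm ha hb' (hh.trans (Nat.le_succ _)) hx hy)
            (inv_mem (heightSubgroup_anti (Nat.zero_le h) hw)) hv'
        · rw [← mul_assoc, h', ← mul_assoc, ← h'']
          group
  -- This level exceeds the height of every member of `l`, so its subgroup is trivial.
  obtain ⟨x, hx, v, hv, rfl⟩ := key ((l.map ht).sum + 1)
  have hbot : heightSubgroup X p ht ((l.map ht).sum + 1) = ⊥ := by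
    refine eq_bot_iff.2 (iSup₂_le fun c hc => ?_)
    have := List.single_le_sum (l := l.map ht) (by simp) (ht c)
      (List.mem_map_of_mem ((hl c).2 hc.1))
    omega
  rw [hbot, Subgroup.mem_bot] at hv
  simpa [hv] using hx

end GroupTheory

/-! ### Weyl conjugates of combinations of simple roots. -/

section Roots

variable {ι E F : Type*} [AddCommGroup E] [Module ℚ E] [AddCommGroup F] [Module ℚ F]
  {P : RootPairing ι ℚ E F} {b : P.Base}

/-- The product of the reflections `s_{i₁} ⋯ s_{iₖ}`, where `w = [i₁, …, iₖ]`. -/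
def wordRefl (w : List b.support) : E ≃ₗ[ℚ] E := (w.map fun i => P.reflection i).prod

@[simp] theorem wordRefl_nil : wordRefl ([] : List b.support) = 1 := rfl

theorem wordRefl_cons_apply (i : b.support) (w : List b.support) (v : E) :
    wordRefl (i :: w) v = P.reflection i (wordRefl w v) := by
  simp [wordRefl]

theorem foldr_reflection_eq (w : List b.support) (v : E) :
    w.foldr (fun (j : b.support) v => P.reflection j v) v = wordRefl w v := by
  induction w with
  | nil => rfl
  | cons i w ih => rw [List.foldr_cons, ih, wordRefl_cons_apply]

theorem wordRefl_symm_root_mem_range (w : List b.support) (a : ι) :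
    (wordRefl w).symm (P.root a) ∈ Set.range P.root := by
  induction w generalizing a with
  | nil => exact ⟨a, rfl⟩
  | cons i w ih =>
    obtain ⟨a', h⟩ := ih (P.reflectionPerm i a)
    refine ⟨a', ?_⟩
    rw [h, LinearEquiv.eq_symm_apply, wordRefl_cons_apply, LinearEquiv.apply_symm_apply,
      RootPairing.root_reflectionPerm, RootPairing.reflection_same]

/-- `v` is a linear combination of simple roots with natural coefficients. -/
def IsNatComb (b : P.Base) (v : E) : Prop := ∃ k : b.support → ℕ, v = ∑ j, k j • P.root j

theorem IsNatComb.root (i : b.support) : IsNatComb b (P.root i) := by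
  classical
  exact ⟨Pi.single i 1, by simp [Pi.single_apply, ite_smul]⟩

theorem IsNatComb.add {v w : E} (hv : IsNatComb b v) (hw : IsNatComb b w) :
    IsNatComb b (v + w) := by
  obtain ⟨k, rfl⟩ := hv
  obtain ⟨l, rfl⟩ := hw
  exact ⟨k + l, by simp [add_smul, Finset.sum_add_distrib]⟩

variable [P.IsRootSystem]

theorem repr_sum_smul_root (k : b.support → ℕ) (i : b.support) :
    b.toWeightBasis.repr (∑ j, k j • P.root j) i = k i := by
  classical
  have : ∑ j, k j • P.root j = ∑ j, (k j : ℚ) • b.toWeightBasis j := by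
    simp [Nat.cast_smul_eq_nsmul]
  rw [this, Module.Basis.repr_sum_self]

/-- The height of a vector: the sum of its coordinates with respect to the simple roots. -/
def heightFun (b : P.Base) : E →ₗ[ℚ] ℚ := b.toWeightBasis.constr ℚ fun _ => 1

@[simp] theorem heightFun_root (i : b.support) : heightFun b (P.root i) = 1 := by
  rw [heightFun, ← b.toWeightBasis_apply, Module.Basis.constr_basis]

theorem heightFun_sum (k : b.support → ℕ) :
    heightFun b (∑ j, k j • P.root j) = (∑ j, k j : ℕ) := by
  simp

variable [Finite ι]

/-- Otherwise $(v,v)=\sum_j k_j(v,\alpha_j)\le 0$ for the positive definite root form. -/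
theorem exists_coroot'_pos {v : E} (hv : IsNatComb b v) (h0 : v ≠ 0) :
    ∃ i : b.support, 0 < P.coroot' i v := by
  cases nonempty_fintype ι
  by_contra! h
  have hneg : ∀ i : b.support, P.RootForm v (P.root i) ≤ 0 := by
    intro i
    have h1 := P.rootForm_self_smul_coroot i
    have h2 := congrArg (P.toLinearMap v) h1
    have h3 : P.toLinearMap v (P.Polarization (P.root i)) = P.RootForm v (P.root i) := by
      rw [P.toLinearMap_apply_apply_Polarization, ← P.rootForm_symmetric.eq]
      rfl
    have h4 : P.toLinearMap v (P.coroot i) = P.coroot' i v := rfl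
    rw [map_smul, map_nsmul, h3, h4, smul_eq_mul, nsmul_eq_mul] at h2
    have h5 := P.zero_le_rootForm (P.root i)
    have h6 := mul_nonpos_of_nonneg_of_nonpos h5 (h i)
    push_cast at h2
    linarith
  have hpos : 0 < P.RootForm v v := P.rootForm_pos_of_ne_zero (by simp) h0
  obtain ⟨k, hk⟩ := hv
  have : P.RootForm v v = ∑ j, k j • P.RootForm v (P.root j) := by
    conv_lhs => rw [show P.RootForm v v = P.RootForm v (∑ j, k j • P.root j) by rw [← hk]]
    simp
  have h' : ∑ j : b.support, k j • P.RootForm v (P.root j) ≤ 0 :=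
    Finset.sum_nonpos fun j _ => by
      simpa using mul_nonpos_of_nonneg_of_nonpos (Nat.cast_nonneg (α := ℚ) (k j)) (hneg j)
  linarith

/-- Induction on height: reflecting in an $\alpha_i$ with $(v,\alpha_i^\vee)>0$ lowers the height.
If $s_iv$ has non-positive coordinates instead, then, because $s_i$ alters only the $i$-th
coordinate, all the others vanish and $v$ is a multiple of $\alpha_i$. -/
theorem exists_word_of_isNatComb {v : E} (h0 : v ≠ 0) (hv : IsNatComb b v)
    (h : ∀ w : List b.support, IsNatComb b (wordRefl w v) ∨ IsNatComb b (-wordRefl w v)) :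
    ∃ (w : List b.support) (i : b.support) (m : ℕ), 0 < m ∧ wordRefl w v = m • P.root i := by
  obtain ⟨k, hk⟩ := hv
  induction hN : ∑ j, k j using Nat.strong_induction_on generalizing v k with
  | _ N ih =>
    obtain ⟨i, hi⟩ := exists_coroot'_pos ⟨k, hk⟩ h0
    have hs : P.reflection i v = v - P.coroot' i v • P.root i := P.reflection_apply i v
    have hsi := h [i]
    rw [wordRefl_cons_apply, wordRefl_nil, LinearEquiv.coe_one, id] at hsi
    obtain ⟨k', hk'⟩ | ⟨k', hk'⟩ := hsi
    · have hlt : ∑ j, k' j < N := by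
        have h1 := congrArg (heightFun b) hs
        rw [map_sub, map_smul, heightFun_root, hk', heightFun_sum, hk, heightFun_sum, ← hk, hN,
          smul_eq_mul, mul_one] at h1
        have : ((∑ j, k' j : ℕ) : ℚ) < N := by linarith
        exact_mod_cast this
      obtain ⟨w, j, m, hm, hw⟩ := ih _ hlt (v := P.reflection i v) (by simpa using h0)
        (fun w => by
          have := h (w ++ [i])
          simpa [wordRefl] using this) k' hk' rfl
      exact ⟨w ++ [i], j, m, hm, by simpa [wordRefl] using hw⟩
    · have hz : ∀ j ≠ i, k j = 0 := by
        intro j hj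
        have h1 := congrArg (fun x => b.toWeightBasis.repr x j) hs
        have h2 : P.reflection i v = -∑ j, k' j • P.root j := by rw [← hk', neg_neg]
        simp only [h2, map_neg, map_sub, map_smul, Finsupp.neg_apply, Finsupp.sub_apply,
          Finsupp.smul_apply, repr_sum_smul_root, b.toWeightBasis_repr_root,
          Finsupp.single_eq_of_ne hj] at h1
        conv_rhs at h1 => rw [hk, repr_sum_smul_root]
        have h3 : ((k j + k' j : ℕ) : ℚ) = 0 := by
          push_cast
          rw [smul_zero, sub_zero] at h1
          linarith
        have : k j + k' j = 0 := by exact_mod_cast h3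
        omega
      have hv : v = k i • P.root i := by
        rw [hk, Finset.sum_eq_single i (fun j _ hj => by rw [hz j hj, zero_smul]) (by simp)]
      refine ⟨[], i, k i, Nat.pos_of_ne_zero fun h => h0 (by rw [hv, h, zero_smul]), ?_⟩
      simpa using hv

/-- A non-zero vector all of whose conjugates are, up to sign, natural combinations of simple roots
is conjugate to a multiple of a simple root. -/
theorem exists_word_of_forall_isNatComb {v : E} (h0 : v ≠ 0)
    (h : ∀ w : List b.support, IsNatComb b (wordRefl w v) ∨ IsNatComb b (-wordRefl w v)) :
    ∃ (w : List b.support) (i : b.support) (m : ℕ), 0 < m ∧ wordRefl w v = m • P.root i := by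
  obtain hv | hv := h []
  · exact exists_word_of_isNatComb h0 hv h
  · obtain ⟨w, i, m, hm, hw⟩ := exists_word_of_isNatComb (v := -v) (neg_ne_zero.2 h0) hv
      fun w => by rw [map_neg, neg_neg]; exact (h w).symm
    refine ⟨i :: w, i, m, hm, ?_⟩
    rw [map_neg, neg_eq_iff_eq_neg] at hw
    rw [wordRefl_cons_apply, hw, map_neg, map_nsmul, RootPairing.reflection_apply_self,
      smul_neg, neg_neg]

end Roots

/-! ### A triangular span stable under bracketing with the generators. -/

section Triangular

variable {K L I D : Type*} [Field K] [LieRing L] [LieAlgebra K L] [AddCommGroup D] [Module K D]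

/-- Iterated brackets `[e_{i₁}, [e_{i₂}, … [e_{iₖ}, e_i] … ]]`. -/
def iterBracket (e : I → L) : List I → I → L
  | [], i => e i
  | j :: w, i => ⁅e j, iterBracket e w i⁆

/-- The span of the iterated brackets. -/
def bracketSpan (K : Type*) [Field K] [LieAlgebra K L] (e : I → L) : Submodule K L :=
  Submodule.span K {x | ∃ w i, x = iterBracket e w i}

theorem iterBracket_mem (e : I → L) (w : List I) (i : I) :
    iterBracket e w i ∈ bracketSpan K e :=
  Submodule.subset_span ⟨w, i, rfl⟩

theorem lie_mem_bracketSpan (e : I → L) (i : I) {x : L} (hx : x ∈ bracketSpan K e) :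
    ⁅e i, x⁆ ∈ bracketSpan K e := by
  unfold bracketSpan at hx
  induction hx using Submodule.span_induction with
  | mem x hx =>
    obtain ⟨w, j, rfl⟩ := hx
    exact iterBracket_mem e (i :: w) j
  | zero => simp
  | add x y _ _ hx hy => simpa using add_mem hx hy
  | smul a x _ hx => simpa using Submodule.smul_mem _ a hx

/-- The innermost bracket is `⁅e i, e i⁆ = 0`. -/
theorem iterBracket_eq_zero (e : I → L) (i : I) {w : List I} (hw : w ≠ [])
    (h : ∀ j ∈ w, j = i) : iterBracket e w i = 0 := by
  induction w with
  | nil => exact absurd rfl hw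
  | cons j w ih =>
    obtain rfl := h j (by simp)
    rw [iterBracket]
    by_cases hw' : w = []
    · simp [hw', iterBracket]
    · rw [ih hw' fun k hk => h k (by simp [hk]), lie_zero]

/-- The span of the brackets in the `e_i`, of the image of `d` and of the brackets in the `f_i`. -/
def triSpan (e f : I → L) (d : D →ₗ[K] L) : Submodule K L :=
  bracketSpan K e ⊔ LinearMap.range d ⊔ bracketSpan K f

theorem triSpan_comm (e f : I → L) (d : D →ₗ[K] L) : triSpan e f d = triSpan f e d := by
  rw [triSpan, triSpan, sup_assoc, sup_comm, sup_comm (bracketSpan K f)]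

theorem lie_iterBracket {e : I → L} {d : D →ₗ[K] L} {a : I → D → K}
    (hde : ∀ φ i, ⁅d φ, e i⁆ = a i φ • e i) (φ : D) (w : List I) (i : I) :
    ⁅d φ, iterBracket e w i⁆ = (a i φ + (w.map fun j => a j φ).sum) • iterBracket e w i := by
  induction w with
  | nil => simp [iterBracket, hde]
  | cons j w ih =>
    rw [iterBracket, leibniz_lie, hde, ih, smul_lie, lie_smul, ← add_smul, List.map_cons,
      List.sum_cons]
    ring_nf

variable [DecidableEq I]

/-- The only real case is a bracket of `f`'s, by induction on the word:
$[e_i,[f_l,y]]=[[e_i,f_l],y]+[f_l,[e_i,y]]$, where $[e_i,f_l]$ is zero or diagonal and so acts on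
$y$ by a scalar. Only stability under each `e i` is needed, not closure under all brackets. -/
theorem lie_mem_triSpan {e f : I → L} {d : D →ₗ[K] L} {a a' : I → D → K} {k : I → D}
    (hde : ∀ φ i, ⁅d φ, e i⁆ = a i φ • e i) (hdf : ∀ φ i, ⁅d φ, f i⁆ = a' i φ • f i)
    (hef : ∀ i j, ⁅e i, f j⁆ = if i = j then d (k i) else 0) (i : I) {x : L}
    (hx : x ∈ triSpan e f d) : ⁅e i, x⁆ ∈ triSpan e f d := by
  have hf : ∀ w j, ⁅e i, iterBracket f w j⁆ ∈ LinearMap.range d ⊔ bracketSpan K f := by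
    intro w j
    induction w with
    | nil =>
      rw [iterBracket, hef]
      split_ifs
      · exact Submodule.mem_sup_left ⟨_, rfl⟩
      · exact zero_mem _
    | cons l w ih =>
      rw [iterBracket, leibniz_lie, hef]
      refine add_mem (Submodule.mem_sup_right ?_) (Submodule.mem_sup_right ?_)
      · split_ifs
        · rw [lie_iterBracket hdf]
          exact Submodule.smul_mem _ _ (iterBracket_mem f w j)
        · simp
      · obtain ⟨_, ⟨φ, rfl⟩, y, hy, h⟩ := Submodule.mem_sup.1 ih
        rw [← h, lie_add, ← lie_skew, hdf]
        exact add_mem (neg_mem (Submodule.smul_mem _ _ (iterBracket_mem f [] l)))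
          (lie_mem_bracketSpan f l hy)
  obtain ⟨y, hy, z, hz, rfl⟩ := Submodule.mem_sup.1 hx
  obtain ⟨y, hy', _, ⟨φ, rfl⟩, rfl⟩ := Submodule.mem_sup.1 hy
  rw [lie_add, lie_add]
  refine add_mem (Submodule.mem_sup_left (add_mem (Submodule.mem_sup_left ?_)
    (Submodule.mem_sup_left ?_))) ?_
  · exact lie_mem_bracketSpan e i hy'
  · rw [← lie_skew, hde]
    exact neg_mem (Submodule.smul_mem _ _ (iterBracket_mem e [] i))
  · rw [triSpan, sup_assoc]
    refine Submodule.mem_sup_right ?_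
    clear hx
    unfold bracketSpan at hz
    induction hz using Submodule.span_induction with
    | mem x hx =>
      obtain ⟨w, j, rfl⟩ := hx
      exact hf w j
    | zero => simp
    | add x y _ _ hx hy => simpa using add_mem hx hy
    | smul c x _ hx => simpa using Submodule.smul_mem _ c hx

end Triangular

/-! ### Minuscule weights and the commutation of $e_i$ with $f_j$. -/

section Relations

variable {ι E F : Type*} [AddCommGroup E] [Module ℚ E] [AddCommGroup F] [Module ℚ F]
  {P : RootPairing ι ℚ E F} {b : P.Base} {Ψ : Set E}

theorem IsMinusculeUnion.coroot'_eq (hΨ : IsMinusculeUnion b Ψ) {v : E} (hv : v ∈ Ψ) (a : ι) :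
    P.coroot' a v = 0 ∨ P.coroot' a v = 1 ∨ P.coroot' a v = -1 := by
  obtain ⟨S, hS, rfl⟩ := hΨ.eq_iUnion_orbit
  simp only [Set.mem_iUnion] at hv
  obtain ⟨s, hs, ⟨⟨g, hg⟩, rfl⟩⟩ := hv
  have : Nonempty ι := ⟨a⟩
  have key : ∀ g : P.Aut, ∀ hg : g ∈ P.weylGroup, ∀ (v : E),
      (∀ a, P.coroot' a v = 0 ∨ P.coroot' a v = 1 ∨ P.coroot' a v = -1) →
      ∀ a, P.coroot' a ((⟨g, hg⟩ : P.weylGroup) • v) = 0 ∨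
        P.coroot' a ((⟨g, hg⟩ : P.weylGroup) • v) = 1 ∨
        P.coroot' a ((⟨g, hg⟩ : P.weylGroup) • v) = -1 := by
    intro g hg
    induction hg using RootPairing.weylGroup.induction' with
    | mem i =>
      intro v hv a
      have h := P.coroot'_reflection (i := i) (j := a) v
      have h' := hv (P.reflectionPerm i a)
      rw [← h] at h'
      exact h'
    | mul g₁ g₂ hg₁ hg₂ h₁ h₂ =>
      intro v hv a
      exact h₁ _ (h₂ v hv) a
  exact key g hg s (hS s hs).coroot_eq a

variable {R M : Type*} [CommRing R] [AddCommGroup M] [Module R M]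

/-- The basis vector `z_v`, extended by zero to all `v`. -/
def zExt (z : Module.Basis Ψ R M) (v : E) : M :=
  open Classical in if h : v ∈ Ψ then z ⟨v, h⟩ else 0

omit [AddCommGroup E] [Module ℚ E] in
@[simp] theorem zExt_coe (z : Module.Basis Ψ R M) (μ : Ψ) : zExt z μ = z μ := by
  simp [zExt]

omit [AddCommGroup E] [Module ℚ E] in
theorem zExt_of_notMem (z : Module.Basis Ψ R M) {v : E} (h : v ∉ Ψ) : zExt z v = 0 := by
  simp [zExt, h]

/-- No membership in `Ψ` is required: if $(v,\alpha_i^\vee)=-1$ and $v+\alpha_i\in\Psi$, then $s_i$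
brings it back to $v\in\Psi$. -/
theorem eMap_zExt (hΨ : IsMinusculeUnion b Ψ) (z : Module.Basis Ψ R M) (i : b.support) (v : E) :
    eMap hΨ z i (zExt z v) = if P.coroot' i v = -1 then zExt z (v + P.root i) else 0 := by
  by_cases hv : v ∈ Ψ
  · rw [zExt, dif_pos hv, eMap, Module.Basis.constr_basis]
    split_ifs with h
    · rw [zExt, dif_pos]
    · rfl
  · rw [zExt_of_notMem z hv, map_zero]
    split_ifs with h
    · rw [zExt_of_notMem]
      intro h'
      refine hv ?_
      have := hΨ.sub_mem i h' (by
        rw [map_add, h, RootPairing.root_coroot'_eq_pairing, RootPairing.pairing_same]; norm_num)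
      simpa using this
    · rfl

theorem fMap_zExt (hΨ : IsMinusculeUnion b Ψ) (z : Module.Basis Ψ R M) (i : b.support) (v : E) :
    fMap hΨ z i (zExt z v) = if P.coroot' i v = 1 then zExt z (v - P.root i) else 0 := by
  by_cases hv : v ∈ Ψ
  · rw [zExt, dif_pos hv, fMap, Module.Basis.constr_basis]
    split_ifs with h
    · rw [zExt, dif_pos]
    · rfl
  · rw [zExt_of_notMem z hv, map_zero]
    split_ifs with h
    · rw [zExt_of_notMem]
      intro h'
      refine hv ?_
      have := hΨ.add_mem i h' (by
        rw [map_sub, h, RootPairing.root_coroot'_eq_pairing, RootPairing.pairing_same]; norm_num)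
      simpa using this
    · rfl

variable [Finite ι] [P.IsCrystallographic]

theorem coroot'_root_nonpos {i j : b.support} (hij : i ≠ j) : P.coroot' i (P.root j) ≤ 0 := by
  rw [RootPairing.root_coroot'_eq_pairing, ← P.algebraMap_pairingIn ℤ]
  have := b.pairingIn_le_zero_of_ne (i := j) (j := i) (fun h => hij (Subtype.ext h.symm)) j.2 i.2
  simpa using this

/-- If either composite is non-zero on $z_\mu$, then $(\mu,\cdot)\in\{0,\pm1\}$ together with
non-positivity of $(\alpha_j,\alpha_i^\vee)$ and $(\alpha_i,\alpha_j^\vee)$ forces both pairings to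
be 0; the two conditions on $\mu$ then coincide. -/
theorem eMap_mul_fMap_of_ne (hΨ : IsMinusculeUnion b Ψ) (z : Module.Basis Ψ R M)
    {i j : b.support} (hij : i ≠ j) :
    eMap hΨ z i * fMap hΨ z j = fMap hΨ z j * eMap hΨ z i := by
  refine z.ext fun μ => ?_
  rw [Module.End.mul_apply, Module.End.mul_apply, ← zExt_coe, eMap_zExt, fMap_zExt, apply_ite
    (eMap hΨ z i), apply_ite (fMap hΨ z j), eMap_zExt, fMap_zExt, map_zero, map_zero, ← ite_and,
    ← ite_and]
  have hp := coroot'_root_nonpos hij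
  have hq := coroot'_root_nonpos hij.symm
  have hpq : P.coroot' i (P.root j) = 0 ↔ P.coroot' j (P.root i) = 0 := by
    rw [RootPairing.root_coroot'_eq_pairing, RootPairing.root_coroot'_eq_pairing]
    exact P.pairing_eq_zero_iff
  rw [show (μ : E) - P.root j + P.root i = μ + P.root i - P.root j by abel]
  congr 1
  rw [map_sub, map_add, eq_iff_iff]
  constructor
  · rintro ⟨h1, h2⟩
    have h3 : P.coroot' i (P.root j) = 0 := by
      rcases hΨ.coroot'_eq μ.2 i with h | h | h <;> rw [h] at h2 <;> linarith
    exact ⟨by linarith, by linarith [hpq.1 h3]⟩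
  · rintro ⟨h1, h2⟩
    have h3 : P.coroot' j (P.root i) = 0 := by
      rcases hΨ.coroot'_eq μ.2 j with h | h | h <;> rw [h] at h2 <;> linarith
    exact ⟨by linarith, by linarith [hpq.2 h3]⟩

end Relations

/-! ### Weights of operators over $\mathbb{Q}$ and projection to a weight. -/

section Weights

variable {ι E F : Type*} [AddCommGroup E] [Module ℚ E] [AddCommGroup F] [Module ℚ F]
  {P : RootPairing ι ℚ E F} {b : P.Base} {Ψ : Set E}
  {V : Type*} [AddCommGroup V] [Module ℚ V]

/-- The diagonal operator with eigenvalue `φ μ` on `z_μ`. -/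
def diagMap (z : Module.Basis Ψ ℚ V) : Module.Dual ℚ E →ₗ[ℚ] Module.End ℚ V where
  toFun φ := z.constr ℚ fun μ => φ μ • z μ
  map_add' φ ψ := z.ext fun μ => by simp [add_smul]
  map_smul' c φ := z.ext fun μ => by simp [mul_smul]

theorem diagMap_zExt (z : Module.Basis Ψ ℚ V) (φ : Module.Dual ℚ E) (v : E) :
    diagMap z φ (zExt z v) = φ v • zExt z v := by
  by_cases hv : v ∈ Ψ
  · simp [zExt, hv, diagMap]
  · simp [zExt_of_notMem z hv]

/-- The operator `X` has weight `v`, that is, it maps `z_μ` to a multiple of `z_{μ + v}`. -/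
def HasWeight (z : Module.Basis Ψ ℚ V) (X : Module.End ℚ V) (v : E) : Prop :=
  ∀ φ, ⁅diagMap z φ, X⁆ = φ v • X

theorem HasWeight.mul {z : Module.Basis Ψ ℚ V} {X Y : Module.End ℚ V} {v w : E}
    (hX : HasWeight z X v) (hY : HasWeight z Y w) : HasWeight z (X * Y) (v + w) := by
  intro φ
  have h1 := hX φ
  have h2 := hY φ
  rw [Ring.lie_def] at h1 h2 ⊢
  have : diagMap z φ * (X * Y) - X * Y * diagMap z φ =
    (diagMap z φ * X - X * diagMap z φ) * Y + X * (diagMap z φ * Y - Y * diagMap z φ) := by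
    noncomm_ring
  rw [this, h1, h2, map_add, add_smul, smul_mul_assoc, mul_smul_comm]

theorem HasWeight.sub {z : Module.Basis Ψ ℚ V} {X Y : Module.End ℚ V} {v : E}
    (hX : HasWeight z X v) (hY : HasWeight z Y v) : HasWeight z (X - Y) v := by
  intro φ
  have h1 := hX φ
  have h2 := hY φ
  rw [Ring.lie_def] at h1 h2 ⊢
  rw [smul_sub, ← h1, ← h2]
  noncomm_ring

theorem HasWeight.lie {z : Module.Basis Ψ ℚ V} {X Y : Module.End ℚ V} {v w : E}
    (hX : HasWeight z X v) (hY : HasWeight z Y w) : HasWeight z ⁅X, Y⁆ (v + w) := by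
  rw [Ring.lie_def]
  exact (hX.mul hY).sub (by rw [add_comm]; exact hY.mul hX)

theorem hasWeight_diagMap (z : Module.Basis Ψ ℚ V) (φ : Module.Dual ℚ E) :
    HasWeight z (diagMap z φ) 0 := by
  intro ψ
  rw [map_zero, zero_smul, Ring.lie_def, sub_eq_zero]
  refine z.ext fun μ => ?_
  rw [Module.End.mul_apply, Module.End.mul_apply, ← zExt_coe, diagMap_zExt, diagMap_zExt,
    map_smul, map_smul, diagMap_zExt, diagMap_zExt, smul_comm]

theorem hasWeight_eMap (hΨ : IsMinusculeUnion b Ψ) (z : Module.Basis Ψ ℚ V) (i : b.support) :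
    HasWeight z (eMap hΨ z i) (P.root i) := by
  intro φ
  refine z.ext fun μ => ?_
  rw [Ring.lie_def, LinearMap.sub_apply, Module.End.mul_apply, Module.End.mul_apply,
    LinearMap.smul_apply, ← zExt_coe, diagMap_zExt, map_smul, eMap_zExt]
  split_ifs
  · rw [diagMap_zExt, map_add, add_smul, add_sub_cancel_left]
  · simp

theorem hasWeight_fMap (hΨ : IsMinusculeUnion b Ψ) (z : Module.Basis Ψ ℚ V) (i : b.support) :
    HasWeight z (fMap hΨ z i) (-P.root i) := by
  intro φ
  refine z.ext fun μ => ?_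
  rw [Ring.lie_def, LinearMap.sub_apply, Module.End.mul_apply, Module.End.mul_apply,
    LinearMap.smul_apply, ← zExt_coe, diagMap_zExt, map_smul, fMap_zExt]
  split_ifs
  · rw [diagMap_zExt, map_sub, sub_smul, map_neg, neg_smul]
    abel
  · simp

theorem lie_eMap_fMap_self (hΨ : IsMinusculeUnion b Ψ) (z : Module.Basis Ψ ℚ V)
    (i : b.support) : ⁅eMap hΨ z i, fMap hΨ z i⁆ = diagMap z (P.coroot' i) := by
  refine z.ext fun μ => ?_
  rw [Ring.lie_def, LinearMap.sub_apply, Module.End.mul_apply, Module.End.mul_apply, ← zExt_coe,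
    diagMap_zExt, eMap_zExt, fMap_zExt]
  rcases hΨ.coroot'_eq μ.2 i with h | h | h <;> rw [h]
  · simp
  · have h' : P.coroot' i (μ - P.root i) = -1 := by
      rw [map_sub, h, RootPairing.root_coroot'_eq_pairing, RootPairing.pairing_same]; norm_num
    rw [if_pos rfl, if_neg (by norm_num), eMap_zExt, h', if_pos rfl]
    simp
  · have h' : P.coroot' i (μ + P.root i) = 1 := by
      rw [map_add, h, RootPairing.root_coroot'_eq_pairing, RootPairing.pairing_same]; norm_num
    rw [if_neg (by norm_num), if_pos rfl, fMap_zExt, h', if_pos rfl]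
    simp

open Classical in
theorem lie_eMap_fMap [Finite ι] [P.IsCrystallographic] (hΨ : IsMinusculeUnion b Ψ)
    (z : Module.Basis Ψ ℚ V) (i j : b.support) :
    ⁅eMap hΨ z i, fMap hΨ z j⁆ = if i = j then diagMap z (P.coroot' i) else 0 := by
  split_ifs with h
  · rw [← h, lie_eMap_fMap_self]
  · rw [Ring.lie_def, eMap_mul_fMap_of_ne hΨ z h, sub_self]

/-- The projection of an operator to its part of weight `v`. -/
def weightProj (z : Module.Basis Ψ ℚ V) (v : E) : Module.End ℚ V →ₗ[ℚ] Module.End ℚ V where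
  toFun X := open Classical in z.constr ℚ fun μ =>
    if h : (μ : E) + v ∈ Ψ then z.repr (X (z μ)) ⟨μ + v, h⟩ • z ⟨μ + v, h⟩ else 0
  map_add' X Y := z.ext fun μ => by
    simp only [Module.Basis.constr_basis, LinearMap.add_apply]
    split_ifs
    · simp [add_smul]
    · simp
  map_smul' c X := z.ext fun μ => by
    simp only [Module.Basis.constr_basis, LinearMap.smul_apply, RingHom.id_apply]
    split_ifs
    · simp [mul_smul]
    · simp

theorem repr_diagMap (z : Module.Basis Ψ ℚ V) (φ : Module.Dual ℚ E) (x : V) (μ : Ψ) :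
    z.repr (diagMap z φ x) μ = φ μ * z.repr x μ := by
  have : (z.coord μ) ∘ₗ (diagMap z φ) = φ μ • z.coord μ := by
    refine z.ext fun μ' => ?_
    by_cases h : μ' = μ
    · subst h; simp [diagMap]
    · simp [diagMap, h]
  simpa using LinearMap.congr_fun this x

/-- The matrix entry is killed by $\varphi(\mu'-\mu-v)$ for every functional $\varphi$, and
functionals separate points. -/
theorem HasWeight.repr_eq_zero {z : Module.Basis Ψ ℚ V} {X : Module.End ℚ V} {v : E}
    (hX : HasWeight z X v) {μ μ' : Ψ} (h : (μ' : E) ≠ μ + v) : z.repr (X (z μ)) μ' = 0 := by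
  by_contra h0
  refine h (sub_eq_zero.1 ((Module.forall_dual_apply_eq_zero_iff ℚ _).1 fun φ => ?_))
  have h1 := congrArg (fun Y : Module.End ℚ V => z.repr (Y (z μ)) μ') (hX φ)
  have h2 : diagMap z φ (z μ) = φ μ • z μ := by rw [← zExt_coe, diagMap_zExt]
  simp only [Ring.lie_def, LinearMap.sub_apply, Module.End.mul_apply, LinearMap.smul_apply, h2,
    map_sub, map_smul, Finsupp.sub_apply, Finsupp.smul_apply, repr_diagMap, smul_eq_mul] at h1
  have h3 : (φ μ' - φ μ - φ v) * z.repr (X (z μ)) μ' = 0 := by linarith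
  rw [map_sub, map_add, ← sub_sub]
  exact (mul_eq_zero.1 h3).resolve_right h0

theorem weightProj_of_hasWeight {z : Module.Basis Ψ ℚ V} {X : Module.End ℚ V} {v : E}
    (hX : HasWeight z X v) : weightProj z v X = X := by
  refine z.ext fun μ => z.repr.injective (Finsupp.ext fun μ' => ?_)
  simp only [weightProj, LinearMap.coe_mk, AddHom.coe_mk, Module.Basis.constr_basis]
  by_cases h' : (μ' : E) = μ + v
  · have hm : (μ : E) + v ∈ Ψ := h' ▸ μ'.2
    obtain rfl : μ' = ⟨μ + v, hm⟩ := Subtype.ext h'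
    rw [dif_pos hm]
    simp
  · rw [hX.repr_eq_zero h']
    split_ifs with h
    · rw [map_smul, Finsupp.smul_apply, Module.Basis.repr_self, Finsupp.single_eq_of_ne,
        smul_zero]
      exact fun h'' => h' (by rw [h''])
    · simp

theorem weightProj_eq_zero {z : Module.Basis Ψ ℚ V} {X : Module.End ℚ V} {v w : E}
    (hX : HasWeight z X v) (h : w ≠ v) : weightProj z w X = 0 := by
  refine z.ext fun μ => ?_
  simp only [weightProj, LinearMap.coe_mk, AddHom.coe_mk, Module.Basis.constr_basis,
    LinearMap.zero_apply]
  split_ifs with hm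
  · rw [hX.repr_eq_zero, zero_smul]
    simpa using h
  · rfl

end Weights

/-! ### Conjugation by unipotent elements and by $n_i$. -/

section Conjugation

variable {ι E F : Type*} [AddCommGroup E] [Module ℚ E] [AddCommGroup F] [Module ℚ F]
  {P : RootPairing ι ℚ E F} {b : P.Base} {Ψ : Set E}
  {R M : Type*} [CommRing R] [AddCommGroup M] [Module R M]

theorem val_unip (e : Module.End R M) (he : e * e = 0) (t : R) :
    (unip e he t : Module.End R M) = 1 + t • e := rfl

theorem val_unip_inv (e : Module.End R M) (he : e * e = 0) (t : R) :
    ((unip e he t)⁻¹ : LinearMap.GeneralLinearGroup R M) = (1 - t • e : Module.End R M) := rfl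

theorem xSimple_mem (hΨ : IsMinusculeUnion b Ψ) (z : Module.Basis Ψ R M) (i : b.support) (t : R) :
    xSimple hΨ z i t ∈ chevalleyGroup hΨ z :=
  Subgroup.subset_closure (Or.inl ⟨i, t, rfl⟩)

theorem ySimple_mem (hΨ : IsMinusculeUnion b Ψ) (z : Module.Basis Ψ R M) (i : b.support) (t : R) :
    ySimple hΨ z i t ∈ chevalleyGroup hΨ z :=
  Subgroup.subset_closure (Or.inr ⟨i, t, rfl⟩)

theorem nElt_mem (hΨ : IsMinusculeUnion b Ψ) (z : Module.Basis Ψ R M) (i : b.support) (t : Rˣ) :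
    nElt hΨ z i t ∈ chevalleyGroup hΨ z :=
  mul_mem (mul_mem (xSimple_mem hΨ z i t) (ySimple_mem hΨ z i _)) (xSimple_mem hΨ z i t)

theorem nWord_mem (hΨ : IsMinusculeUnion b Ψ) (z : Module.Basis Ψ R M) (w : List b.support) :
    nWord hΨ z w ∈ chevalleyGroup hΨ z :=
  list_prod_mem fun x hx => by
    obtain ⟨i, -, rfl⟩ := List.mem_map.1 hx
    exact nElt_mem hΨ z i 1

theorem nWord_cons (hΨ : IsMinusculeUnion b Ψ) (z : Module.Basis Ψ R M) (i : b.support)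
    (w : List b.support) : nWord hΨ z (i :: w) = nElt hΨ z i 1 * nWord hΨ z w := by
  simp [nWord]

/-- Only the line spanned by $z_{s_iv}$ matters for weights, so the sign is left unspecified. -/
theorem nElt_zExt (hΨ : IsMinusculeUnion b Ψ) (z : Module.Basis Ψ R M) (i : b.support) {v : E}
    (hv : v ∈ Ψ) :
    ∃ ε : R, (nElt hΨ z i 1 : Module.End R M) (zExt z v) = ε • zExt z (P.reflection i v) := by
  have hs := P.reflection_apply i v
  have key : (nElt hΨ z i 1 : Module.End R M) =
      (1 + eMap hΨ z i) * (1 - fMap hΨ z i) * (1 + eMap hΨ z i) := by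
    simp [nElt, xSimple, ySimple, val_unip, sub_eq_add_neg]
  rw [key]
  simp only [Module.End.mul_apply, LinearMap.add_apply, LinearMap.sub_apply, Module.End.one_apply]
  rcases hΨ.coroot'_eq hv i with h | h | h <;> rw [h] at hs
  · refine ⟨1, ?_⟩
    simp [eMap_zExt, fMap_zExt, h, hs]
  · refine ⟨-1, ?_⟩
    have h' : P.coroot' i (v - P.root i) = -1 := by
      rw [map_sub, h, RootPairing.root_coroot'_eq_pairing, RootPairing.pairing_same]; norm_num
    simp only [eMap_zExt, fMap_zExt, h, hs, map_sub, map_add, one_smul, neg_smul]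
    norm_num [h']
    simp [eMap_zExt, h']
    abel
  · refine ⟨1, ?_⟩
    have h' : P.coroot' i (v + P.root i) = 1 := by
      rw [map_add, h, RootPairing.root_coroot'_eq_pairing, RootPairing.pairing_same]; norm_num
    simp only [eMap_zExt, fMap_zExt, h, hs, map_sub, map_add, h', one_smul, neg_smul, if_true]
    norm_num [h', eMap_zExt, fMap_zExt, h]

/-- As $e^2=0$, one has $[e,[e,x]]=-2exe$, so conjugation is $x+t[e,x]+\tfrac{t^2}{2}[e,[e,x]]$. -/
theorem conj_unip_mem {V : Type*} [AddCommGroup V] [Module ℚ V] {S : Submodule ℚ (Module.End ℚ V)}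
    {e : Module.End ℚ V} (he : e * e = 0) (hS : ∀ x ∈ S, e * x - x * e ∈ S) (t : ℚ)
    {x : Module.End ℚ V} (hx : x ∈ S) :
    (unip e he t : Module.End ℚ V) * x *
      ((unip e he t)⁻¹ : LinearMap.GeneralLinearGroup ℚ V) ∈ S := by
  have key : (1 + t • e) * x * (1 - t • e) = x + t • (e * x - x * e) +
      (t ^ 2 / 2) • (e * (e * x - x * e) - (e * x - x * e) * e) := by
    have h1 : e * (e * x - x * e) - (e * x - x * e) * e = (-2 : ℚ) • (e * x * e) := by
      have : e * (e * x - x * e) - (e * x - x * e) * e =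
        e * e * x + x * (e * e) - (e * x * e + e * x * e) := by noncomm_ring
      rw [this, he]
      simp only [zero_mul, mul_zero]
      module
    rw [h1]
    simp only [mul_sub, add_mul, one_mul, mul_one, smul_mul_assoc, mul_smul_comm, smul_sub]
    module
  rw [val_unip, val_unip_inv, key]
  exact add_mem (add_mem hx (S.smul_mem _ (hS _ hx))) (S.smul_mem _ (hS _ (hS _ hx)))

theorem unip_inv (e : Module.End R M) (he : e * e = 0) (t : R) :
    (unip e he t)⁻¹ = unip e he (-t) := by
  refine Units.ext ?_
  rw [val_unip_inv, val_unip, neg_smul, sub_eq_add_neg]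

end Conjugation

/-! ### The rational Lie space: its weight spaces and its stability under $G$. -/

section LieSpace

attribute [local instance] LieRing.ofAssociativeRing

variable {ι E F : Type*} [AddCommGroup E] [Module ℚ E] [AddCommGroup F] [Module ℚ F]
  {P : RootPairing ι ℚ E F} {b : P.Base} {Ψ : Set E}
  {V : Type*} [AddCommGroup V] [Module ℚ V]

/-- The Lie algebra spanned by the brackets in the `e_i`, those in the `f_i` and the diagonal
operators that are linear in the weight. -/
def lieSpace (hΨ : IsMinusculeUnion b Ψ) (z : Module.Basis Ψ ℚ V) :
    Submodule ℚ (Module.End ℚ V) :=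
  triSpan (eMap hΨ z) (fMap hΨ z) (diagMap z)

theorem hasWeight_iterBracket_eMap (hΨ : IsMinusculeUnion b Ψ) (z : Module.Basis Ψ ℚ V)
    (w : List b.support) (i : b.support) :
    HasWeight z (iterBracket (eMap hΨ z) w i)
      (P.root i + (w.map fun j : b.support => P.root j).sum) := by
  intro φ
  have := lie_iterBracket (e := eMap hΨ z) (d := diagMap z)
    (a := fun (i : b.support) φ => φ (P.root i))
    (fun φ i => hasWeight_eMap hΨ z i φ) φ w i
  rw [map_add, map_list_sum, List.map_map]
  exact this

theorem hasWeight_iterBracket_fMap (hΨ : IsMinusculeUnion b Ψ) (z : Module.Basis Ψ ℚ V)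
    (w : List b.support) (i : b.support) :
    HasWeight z (iterBracket (fMap hΨ z) w i)
      (-(P.root i + (w.map fun j : b.support => P.root j).sum)) := by
  intro φ
  have := lie_iterBracket (e := fMap hΨ z) (d := diagMap z)
    (a := fun (i : b.support) φ => φ (-P.root i))
    (fun φ i => hasWeight_fMap hΨ z i φ) φ w i
  have hn : (w.map fun j : b.support => φ (-P.root j)).sum =
      -(w.map fun j : b.support => φ (P.root j)).sum := by
    clear this
    induction w with
    | nil => simp
    | cons j w ih => rw [List.map_cons, List.sum_cons, ih, List.map_cons, List.sum_cons, map_neg,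
        neg_add]
  rw [map_neg, map_add, map_list_sum, List.map_map, neg_add]
  rwa [hn, map_neg] at this

/-- Projecting to weight $v\neq0$ kills the diagonal operators and every bracket of a different
weight, so only brackets of weight exactly $v$ need checking. -/
theorem mem_of_hasWeight {hΨ : IsMinusculeUnion b Ψ} {z : Module.Basis Ψ ℚ V}
    {X : Module.End ℚ V} {v : E} (hX : X ∈ lieSpace hΨ z) (hw : HasWeight z X v) (hv : v ≠ 0)
    (T : Submodule ℚ (Module.End ℚ V))
    (hE : ∀ (w : List b.support) (i : b.support),
      P.root i + (w.map fun j : b.support => P.root j).sum = v → iterBracket (eMap hΨ z) w i ∈ T)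
    (hF : ∀ (w : List b.support) (i : b.support),
      -(P.root i + (w.map fun j : b.support => P.root j).sum) = v →
        iterBracket (fMap hΨ z) w i ∈ T) :
    X ∈ T := by
  rw [← weightProj_of_hasWeight hw]
  suffices h : lieSpace hΨ z ≤ T.comap (weightProj z v) from h hX
  refine sup_le (sup_le (Submodule.span_le.2 ?_) ?_) (Submodule.span_le.2 ?_)
  · rintro _ ⟨w, i, rfl⟩
    have h := hasWeight_iterBracket_eMap hΨ z w i
    by_cases hc : P.root i + (w.map fun j : b.support => P.root j).sum = v
    · rw [hc] at h
      simpa [weightProj_of_hasWeight h] using hE w i hc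
    · simp [weightProj_eq_zero h (Ne.symm hc)]
  · rintro _ ⟨φ, rfl⟩
    simp [weightProj_eq_zero (hasWeight_diagMap z φ) hv]
  · rintro _ ⟨w, i, rfl⟩
    have h := hasWeight_iterBracket_fMap hΨ z w i
    by_cases hc : -(P.root i + (w.map fun j : b.support => P.root j).sum) = v
    · rw [hc] at h
      simpa [weightProj_of_hasWeight h] using hF w i hc
    · simp [weightProj_eq_zero h (Ne.symm hc)]

theorem eMap_mem_lieSpace (hΨ : IsMinusculeUnion b Ψ) (z : Module.Basis Ψ ℚ V) (i : b.support) :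
    eMap hΨ z i ∈ lieSpace hΨ z :=
  Submodule.mem_sup_left (Submodule.mem_sup_left (iterBracket_mem (eMap hΨ z) [] i))

theorem isNatComb_root_add_sum (w : List b.support) (i : b.support) :
    IsNatComb b (P.root i + (w.map fun j : b.support => P.root j).sum) := by
  induction w with
  | nil => simpa using IsNatComb.root i
  | cons j w ih =>
    rw [List.map_cons, List.sum_cons, add_left_comm]
    exact (IsNatComb.root j).add ih

theorem eq_zero_of_not_isNatComb {hΨ : IsMinusculeUnion b Ψ} {z : Module.Basis Ψ ℚ V}
    {X : Module.End ℚ V} {v : E} (hX : X ∈ lieSpace hΨ z) (hw : HasWeight z X v) (hv : v ≠ 0)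
    (h1 : ¬ IsNatComb b v) (h2 : ¬ IsNatComb b (-v)) : X = 0 := by
  refine (Submodule.mem_bot ℚ).1 (mem_of_hasWeight hX hw hv ⊥ ?_ ?_)
  · rintro w i rfl
    exact absurd (isNatComb_root_add_sum w i) h1
  · rintro w i rfl
    rw [neg_neg] at h2
    exact absurd (isNatComb_root_add_sum w i) h2

section RootSystem

variable [P.IsRootSystem]

theorem heightFun_root_add_sum (w : List b.support) (i : b.support) :
    heightFun b (P.root i + (w.map fun j : b.support => P.root j).sum) = 1 + w.length := by
  rw [map_add, heightFun_root, map_list_sum, List.map_map]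
  simp [Function.comp_def]

theorem eq_of_root_add_sum_eq {w : List b.support} {i j : b.support} {m : ℕ}
    (h : P.root i + (w.map fun j : b.support => P.root j).sum = m • P.root j) :
    i = j ∧ ∀ k ∈ w, k = j := by
  classical
  have key : ∀ l, l ≠ j → (Pi.single i 1 : b.support → ℚ) l + (w.count l : ℚ) = 0 := by
    intro l hl
    have h1 := congrArg (fun x => b.toWeightBasis.repr x l) h
    have h2 : b.toWeightBasis.repr ((w.map fun j : b.support => P.root j).sum) l = w.count l := by
      clear h h1
      induction w with
      | nil => simp
      | cons k w ih =>
        rw [List.map_cons, List.sum_cons, map_add, Finsupp.add_apply, ih,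
          b.toWeightBasis_repr_root, Finsupp.single_apply, List.count_cons]
        by_cases h : k = l
        · simp [h, add_comm]
        · simp [h]
    simp only [map_add, Finsupp.add_apply, h2, map_nsmul, Finsupp.smul_apply,
      b.toWeightBasis_repr_root, Finsupp.single_eq_of_ne hl, smul_zero] at h1
    rw [← h1]
    congr 1
    simp [Pi.single_apply, Finsupp.single_apply, eq_comm]
  constructor
  · by_contra hne
    have := key i hne
    rw [Pi.single_eq_same] at this
    have h2 : (0 : ℚ) ≤ w.count i := by positivity
    linarith
  · intro k hk
    by_contra hne
    have h1 := key k hne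
    have h2 := List.count_pos_iff.2 hk
    have h3 : (0 : ℚ) < w.count k := by exact_mod_cast h2
    have h4 : (0 : ℚ) ≤ (Pi.single i 1 : b.support → ℚ) k := by
      rw [Pi.single_apply]; split_ifs <;> norm_num
    linarith

/-- A bracket of `e`'s of weight $\alpha_i$ has height 1, hence is $e_i$ itself; brackets of `f`'s
have negative height. -/
theorem exists_eq_smul_eMap {hΨ : IsMinusculeUnion b Ψ} {z : Module.Basis Ψ ℚ V}
    {X : Module.End ℚ V} {i : b.support} (hX : X ∈ lieSpace hΨ z)
    (hw : HasWeight z X (P.root i)) : ∃ q : ℚ, X = q • eMap hΨ z i := by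
  have : X ∈ Submodule.span ℚ {eMap hΨ z i} := by
    refine mem_of_hasWeight hX hw (P.ne_zero i) _ (fun w j h => ?_) fun w j h => ?_
    · have h1 := congrArg (heightFun b) h
      rw [heightFun_root_add_sum, heightFun_root] at h1
      have h2 : w = [] := List.length_eq_zero_iff.1 (by
        have : (w.length : ℚ) = 0 := by linarith
        exact_mod_cast this)
      subst h2
      obtain rfl := (eq_of_root_add_sum_eq (h.trans (one_smul ℕ _).symm)).1
      exact Submodule.mem_span_singleton_self _
    · have h1 := congrArg (heightFun b) h
      rw [map_neg, heightFun_root_add_sum, heightFun_root] at h1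
      have : (0 : ℚ) ≤ w.length := by positivity
      linarith
  obtain ⟨q, hq⟩ := Submodule.mem_span_singleton.1 this
  exact ⟨q, hq.symm⟩

/-- By independence of the simple roots, a bracket of weight $m\alpha_i$ involves only $e_i$, and it
has at least two letters. -/
theorem eq_zero_of_hasWeight_nsmul {hΨ : IsMinusculeUnion b Ψ} {z : Module.Basis Ψ ℚ V}
    {X : Module.End ℚ V} {i : b.support} {m : ℕ} (hm : 2 ≤ m) (hX : X ∈ lieSpace hΨ z)
    (hw : HasWeight z X (m • P.root i)) : X = 0 := by
  have hm' : (2 : ℚ) ≤ m := by exact_mod_cast hm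
  refine (Submodule.mem_bot ℚ).1
    (mem_of_hasWeight hX hw (by
      rw [← Nat.cast_smul_eq_nsmul ℚ]
      exact smul_ne_zero (by linarith) (P.ne_zero i)) ⊥ (fun w j h => ?_) fun w j h => ?_)
  · obtain ⟨rfl, h2⟩ := eq_of_root_add_sum_eq h
    rw [Submodule.mem_bot]
    refine iterBracket_eq_zero _ j ?_ h2
    rintro rfl
    have h1 := congrArg (heightFun b) h
    rw [heightFun_root_add_sum, map_nsmul, heightFun_root, nsmul_eq_mul, List.length_nil] at h1
    push_cast at h1
    linarith
  · have h1 := congrArg (heightFun b) h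
    rw [map_neg, heightFun_root_add_sum, map_nsmul, heightFun_root, nsmul_eq_mul] at h1
    have : (0 : ℚ) ≤ w.length := by positivity
    linarith

end RootSystem

section Crystallographic

variable [Finite ι] [P.IsCrystallographic]

theorem lie_eMap_mem_lieSpace (hΨ : IsMinusculeUnion b Ψ) (z : Module.Basis Ψ ℚ V)
    (i : b.support) {X : Module.End ℚ V} (hX : X ∈ lieSpace hΨ z) :
    eMap hΨ z i * X - X * eMap hΨ z i ∈ lieSpace hΨ z := by
  classical
  exact lie_mem_triSpan (a := fun (i : b.support) φ => φ (P.root i))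
    (a' := fun (i : b.support) φ => φ (-P.root i))
    (k := fun i : b.support => P.coroot' i) (fun φ i => hasWeight_eMap hΨ z i φ)
    (fun φ i => hasWeight_fMap hΨ z i φ)
    (fun i j => by convert lie_eMap_fMap hΨ z i j) i hX

theorem lie_fMap_mem_lieSpace (hΨ : IsMinusculeUnion b Ψ) (z : Module.Basis Ψ ℚ V)
    (i : b.support) {X : Module.End ℚ V} (hX : X ∈ lieSpace hΨ z) :
    fMap hΨ z i * X - X * fMap hΨ z i ∈ lieSpace hΨ z := by
  classical
  rw [lieSpace, triSpan_comm] at hX ⊢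
  refine lie_mem_triSpan (a' := fun (i : b.support) φ => φ (P.root i))
    (a := fun (i : b.support) φ => φ (-P.root i))
    (k := fun i : b.support => -P.coroot' i) (fun φ i => hasWeight_fMap hΨ z i φ)
    (fun φ i => hasWeight_eMap hΨ z i φ) (fun i j => ?_) i hX
  have h := lie_eMap_fMap hΨ z j i
  rw [← neg_inj] at h
  refine Eq.trans ?_ (h.trans ?_)
  · rw [Ring.lie_def, Ring.lie_def, neg_sub]
  · by_cases hij : i = j
    · subst hij; simp
    · simp [hij, Ne.symm hij]

theorem conj_mem_lieSpace {hΨ : IsMinusculeUnion b Ψ} {z : Module.Basis Ψ ℚ V}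
    {g : LinearMap.GeneralLinearGroup ℚ V} (hg : g ∈ chevalleyGroup hΨ z) {X : Module.End ℚ V}
    (hX : X ∈ lieSpace hΨ z) :
    (g : Module.End ℚ V) * X * (g⁻¹ : LinearMap.GeneralLinearGroup ℚ V) ∈ lieSpace hΨ z := by
  -- Treating `g` and its inverse together makes the inverse case of the closure induction a swap.
  suffices h : ∀ X ∈ lieSpace hΨ z,
      (g : Module.End ℚ V) * X * (g⁻¹ : LinearMap.GeneralLinearGroup ℚ V) ∈ lieSpace hΨ z ∧
      ((g⁻¹ : LinearMap.GeneralLinearGroup ℚ V) : Module.End ℚ V) * X * g ∈ lieSpace hΨ z from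
    (h X hX).1
  clear hX X
  unfold chevalleyGroup at hg
  induction hg using Subgroup.closure_induction with
  | mem g hg =>
    intro X hX
    obtain ⟨i, t, rfl⟩ | ⟨i, t, rfl⟩ := hg
    · have h := fun t => conj_unip_mem (eMap_mul_self hΨ z i)
        (fun _ => lie_eMap_mem_lieSpace hΨ z i) t hX
      refine ⟨h t, ?_⟩
      have := h (-t)
      rwa [← unip_inv, inv_inv] at this
    · have h := fun t => conj_unip_mem (fMap_mul_self hΨ z i)
        (fun _ => lie_fMap_mem_lieSpace hΨ z i) t hX
      refine ⟨h t, ?_⟩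
      have := h (-t)
      rwa [← unip_inv, inv_inv] at this
  | one => intro X hX; simpa using hX
  | mul g h _ _ hg hh =>
    intro X hX
    have h1 := (hg _ (hh X hX).1).1
    have h2 := (hh _ (hg X hX).2).2
    rw [mul_inv_rev]
    simp only [Units.val_mul, mul_assoc] at h1 h2 ⊢
    exact ⟨h1, h2⟩
  | inv g _ hg => intro X hX; rw [inv_inv]; exact (hg X hX).symm

end Crystallographic

/-- Conjugation by `g` moves weights by `s`. -/
def MovesWeights (z : Module.Basis Ψ ℚ V) (g : LinearMap.GeneralLinearGroup ℚ V) (s : E ≃ₗ[ℚ] E) :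
    Prop :=
  ∀ φ : Module.Dual ℚ E, diagMap z φ * (g : Module.End ℚ V) = g * diagMap z (φ ∘ₗ s)

theorem MovesWeights.inv {z : Module.Basis Ψ ℚ V} {g : LinearMap.GeneralLinearGroup ℚ V}
    {s : E ≃ₗ[ℚ] E} (h : MovesWeights z g s) : MovesWeights z g⁻¹ s.symm := by
  intro φ
  have h1 := h (φ ∘ₗ s.symm)
  have h2 : (φ ∘ₗ (s.symm : E →ₗ[ℚ] E)) ∘ₗ (s : E →ₗ[ℚ] E) = φ := by ext; simp
  rw [h2] at h1
  rw [Units.eq_inv_mul_iff_mul_eq, ← mul_assoc, ← h1, mul_assoc, Units.mul_inv, mul_one]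

theorem MovesWeights.mul {z : Module.Basis Ψ ℚ V} {g h : LinearMap.GeneralLinearGroup ℚ V}
    {s t : E ≃ₗ[ℚ] E} (hg : MovesWeights z g s) (hh : MovesWeights z h t) :
    MovesWeights z (g * h) (s * t) := by
  intro φ
  rw [Units.val_mul, ← mul_assoc, hg φ, mul_assoc, hh, mul_assoc]
  rfl

theorem MovesWeights.hasWeight {z : Module.Basis Ψ ℚ V} {g : LinearMap.GeneralLinearGroup ℚ V}
    {s : E ≃ₗ[ℚ] E} (h : MovesWeights z g s) {X : Module.End ℚ V} {v : E}
    (hX : HasWeight z X v) :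
    HasWeight z ((g : Module.End ℚ V) * X * (g⁻¹ : LinearMap.GeneralLinearGroup ℚ V)) (s v) := by
  intro φ
  have h1 := hX (φ ∘ₗ s)
  have h2 : ((g⁻¹ : LinearMap.GeneralLinearGroup ℚ V) : Module.End ℚ V) * diagMap z φ =
      diagMap z (φ ∘ₗ s) * (g⁻¹ : LinearMap.GeneralLinearGroup ℚ V) := by
    rw [Units.inv_mul_eq_iff_eq_mul, ← mul_assoc, ← h φ, mul_assoc, Units.mul_inv, mul_one]
  rw [Ring.lie_def] at h1 ⊢
  rw [← mul_assoc, ← mul_assoc, h φ, mul_assoc _ _ (diagMap z φ), h2, ← mul_assoc,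
    mul_assoc _ (diagMap z _) X, mul_assoc _ X (diagMap z _), ← sub_mul, ← mul_sub, h1]
  simp

theorem movesWeights_nElt (hΨ : IsMinusculeUnion b Ψ) (z : Module.Basis Ψ ℚ V) (i : b.support) :
    MovesWeights z (nElt hΨ z i 1) (P.reflection i) := by
  intro φ
  refine z.ext fun μ => ?_
  obtain ⟨ε, hε⟩ := nElt_zExt hΨ z i μ.2
  rw [Module.End.mul_apply, Module.End.mul_apply, ← zExt_coe, diagMap_zExt, hε, map_smul, map_smul,
    diagMap_zExt, hε, smul_comm]
  rfl

theorem movesWeights_nWord (hΨ : IsMinusculeUnion b Ψ) (z : Module.Basis Ψ ℚ V)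
    (w : List b.support) : MovesWeights z (nWord hΨ z w) (wordRefl w) := by
  induction w with
  | nil =>
    intro φ
    rw [nWord, List.map_nil, List.prod_nil, Units.val_one, mul_one, one_mul]
    rfl
  | cons i w ih =>
    rw [nWord_cons]
    exact (movesWeights_nElt hΨ z i).mul ih

end LieSpace

/-! ### Finiteness of $\Psi$ and base change from $\mathbb{Z}$ to $R$. -/

section BaseChange

variable {ι E F : Type*} [AddCommGroup E] [Module ℚ E] [AddCommGroup F] [Module ℚ F]
  {P : RootPairing ι ℚ E F} {b : P.Base} {Ψ : Set E}

/-- The coroots span, so a weight is determined by its pairings with them, each one of three values.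
-/
theorem IsMinusculeUnion.finite [Finite ι] [P.IsRootSystem] (hΨ : IsMinusculeUnion b Ψ) :
    Finite Ψ := by
  have : Finite {q : ℚ // q = 0 ∨ q = 1 ∨ q = -1} :=
    ((Set.toFinite ({0, 1, -1} : Set ℚ)).subset (t := {q | q = 0 ∨ q = 1 ∨ q = -1})
      fun q hq => by simpa using hq).to_subtype
  refine Finite.of_injective
    (fun (μ : Ψ) (a : ι) =>
      (⟨P.coroot' a μ, hΨ.coroot'_eq μ.2 a⟩ : {q : ℚ // q = 0 ∨ q = 1 ∨ q = -1})) ?_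
  intro μ ν h
  have h1 : ∀ a, P.coroot' a (μ : E) = P.coroot' a (ν : E) := fun a =>
    congrArg Subtype.val (congrFun h a)
  have h2 : P.toLinearMap (μ : E) = P.toLinearMap (ν : E) := by
    refine LinearMap.ext_on_range (v := P.coroot) ?_ h1
    exact RootPairing.IsRootSystem.span_coroot_eq_top
  exact Subtype.ext (P.toPerfPair.injective (LinearMap.ext fun f => LinearMap.congr_fun h2 f))

variable [Fintype Ψ] [DecidableEq Ψ] {N : Type*} [AddCommGroup N]
  {R M : Type*} [CommRing R] [AddCommGroup M] [Module R M]

/-- Base change of operators from `ℤ` to `R` along bases with the same index set. -/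
def baseMap (y : Module.Basis Ψ ℤ N) (z : Module.Basis Ψ R M) :
    Module.End ℤ N →+* Module.End R M :=
  (Matrix.toLinAlgEquiv z : Matrix Ψ Ψ R →+* Module.End R M).comp
    ((Int.castRingHom R).mapMatrix.comp
      (LinearMap.toMatrixAlgEquiv y : Module.End ℤ N →+* Matrix Ψ Ψ ℤ))

/-- Base change of vectors. -/
def baseVec (y : Module.Basis Ψ ℤ N) (z : Module.Basis Ψ R M) (n : N) : M :=
  ∑ μ, (y.repr n μ : R) • z μ

omit [AddCommGroup E] [Module ℚ E] [DecidableEq Ψ] in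
theorem repr_baseVec (y : Module.Basis Ψ ℤ N) (z : Module.Basis Ψ R M) (n : N) (μ : Ψ) :
    z.repr (baseVec y z n) μ = y.repr n μ := by
  rw [baseVec, Module.Basis.repr_sum_self]

omit [AddCommGroup E] [Module ℚ E] [DecidableEq Ψ] in
theorem baseVec_zExt (y : Module.Basis Ψ ℤ N) (z : Module.Basis Ψ R M) (v : E) :
    baseVec y z (zExt y v) = zExt z v := by
  classical
  by_cases hv : v ∈ Ψ
  · simp [baseVec, zExt, hv, Finsupp.single_apply, ite_smul]
  · simp [baseVec, zExt_of_notMem _ hv]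

omit [AddCommGroup E] [Module ℚ E] in
theorem baseMap_apply (y : Module.Basis Ψ ℤ N) (z : Module.Basis Ψ R M) (T : Module.End ℤ N)
    (μ : Ψ) : baseMap y z T (z μ) = baseVec y z (T (y μ)) := by
  simp [baseMap, baseVec, Matrix.toLinAlgEquiv_self, LinearMap.toMatrixAlgEquiv_apply]

-- Identities between integral operators may thus be checked over $\mathbb{Q}$ and then transported
-- to any $R$.
omit [AddCommGroup E] [Module ℚ E] in
theorem baseMap_injective (y : Module.Basis Ψ ℤ N) {V : Type*} [AddCommGroup V] [Module ℚ V]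
    (z : Module.Basis Ψ ℚ V) : Function.Injective (baseMap y z) :=
  (Matrix.toLinAlgEquiv z).injective.comp
    ((Matrix.map_injective Int.cast_injective).comp (LinearMap.toMatrixAlgEquiv y).injective)

theorem baseMap_eMap (hΨ : IsMinusculeUnion b Ψ) (y : Module.Basis Ψ ℤ N)
    (z : Module.Basis Ψ R M) (i : b.support) : baseMap y z (eMap hΨ y i) = eMap hΨ z i := by
  refine z.ext fun μ => ?_
  rw [baseMap_apply, ← zExt_coe y, ← zExt_coe z, eMap_zExt, eMap_zExt]
  split_ifs
  · rw [baseVec_zExt]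
  · simp [baseVec]

theorem baseMap_fMap (hΨ : IsMinusculeUnion b Ψ) (y : Module.Basis Ψ ℤ N)
    (z : Module.Basis Ψ R M) (i : b.support) : baseMap y z (fMap hΨ y i) = fMap hΨ z i := by
  refine z.ext fun μ => ?_
  rw [baseMap_apply, ← zExt_coe y, ← zExt_coe z, fMap_zExt, fMap_zExt]
  split_ifs
  · rw [baseVec_zExt]
  · simp [baseVec]

theorem map_nElt (hΨ : IsMinusculeUnion b Ψ) (y : Module.Basis Ψ ℤ N)
    (z : Module.Basis Ψ R M) (i : b.support) :
    Units.map (baseMap y z : Module.End ℤ N →* Module.End R M) (nElt hΨ y i 1) =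
      nElt hΨ z i 1 := by
  refine Units.ext ?_
  simp [nElt, xSimple, ySimple, val_unip, baseMap_eMap, baseMap_fMap]

theorem map_nWord (hΨ : IsMinusculeUnion b Ψ) (y : Module.Basis Ψ ℤ N)
    (z : Module.Basis Ψ R M) (w : List b.support) :
    Units.map (baseMap y z : Module.End ℤ N →* Module.End R M) (nWord hΨ y w) =
      nWord hΨ z w := by
  rw [nWord, map_list_prod, List.map_map, nWord]
  simp only [Function.comp_def, map_nElt]

omit [AddCommGroup E] [Module ℚ E] in
theorem baseMap_conj (y : Module.Basis Ψ ℤ N) (z : Module.Basis Ψ R M)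
    (g : LinearMap.GeneralLinearGroup ℤ N) (T : Module.End ℤ N) :
    baseMap y z ((g : Module.End ℤ N) * T * (g⁻¹ : LinearMap.GeneralLinearGroup ℤ N)) =
      (Units.map (baseMap y z : Module.End ℤ N →* Module.End R M) g : Module.End R M) *
        baseMap y z T * ((Units.map (baseMap y z : Module.End ℤ N →* Module.End R M) g)⁻¹ :
          LinearMap.GeneralLinearGroup R M) := by
  rw [map_mul, map_mul, ← map_inv]
  rfl

theorem baseMap_rootVec (hΨ : IsMinusculeUnion b Ψ) (y : Module.Basis Ψ ℤ N)
    (z : Module.Basis Ψ R M) (c : ∀ a, RootWord b a) (a : ι) :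
    baseMap y z (rootVec hΨ y c a) = rootVec hΨ z c a := by
  rw [rootVec, baseMap_conj, map_nWord, baseMap_eMap, rootVec]

end BaseChange

/-! ### Root spaces over $\mathbb{Q}$ and integrality of the structure constants. -/

section Integrality

variable {ι E F : Type*} [Finite ι] [AddCommGroup E] [Module ℚ E] [AddCommGroup F] [Module ℚ F]
  {P : RootPairing ι ℚ E F} [P.IsRootSystem] [P.IsCrystallographic] {b : P.Base} {Ψ : Set E}
  {V : Type*} [AddCommGroup V] [Module ℚ V]

omit [Finite ι] [P.IsRootSystem] [P.IsCrystallographic] in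
theorem RootWord.wordRefl_root {a : ι} (w : RootWord b a) :
    wordRefl w.word (P.root w.node) = P.root a := by
  rw [w.root_eq, foldr_reflection_eq]

omit [Finite ι] [P.IsRootSystem] [P.IsCrystallographic] in
theorem hasWeight_rootVec (hΨ : IsMinusculeUnion b Ψ) (z : Module.Basis Ψ ℚ V)
    (c : ∀ a, RootWord b a) (a : ι) : HasWeight z (rootVec hΨ z c a) (P.root a) := by
  rw [← (c a).wordRefl_root]
  exact (movesWeights_nWord hΨ z (c a).word).hasWeight (hasWeight_eMap hΨ z _)

omit [P.IsRootSystem] in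
theorem rootVec_mem_lieSpace (hΨ : IsMinusculeUnion b Ψ) (z : Module.Basis Ψ ℚ V)
    (c : ∀ a, RootWord b a) (a : ι) : rootVec hΨ z c a ∈ lieSpace hΨ z :=
  conj_mem_lieSpace (nWord_mem hΨ z _) (eMap_mem_lieSpace hΨ z _)

omit [P.IsRootSystem] in
theorem lie_rootVec_mem_lieSpace {hΨ : IsMinusculeUnion b Ψ} {z : Module.Basis Ψ ℚ V}
    (c : ∀ a, RootWord b a) (a : ι) {X : Module.End ℚ V} (hX : X ∈ lieSpace hΨ z) :
    rootVec hΨ z c a * X - X * rootVec hΨ z c a ∈ lieSpace hΨ z := by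
  have hn := nWord_mem hΨ z (c a).word
  have h := conj_mem_lieSpace hn (lie_eMap_mem_lieSpace hΨ z (c a).node
    (conj_mem_lieSpace (inv_mem hn) hX))
  rw [inv_inv] at h
  convert h using 1
  simp only [rootVec, mul_sub, sub_mul, mul_assoc, Units.mul_inv_cancel_left, Units.mul_inv,
    mul_one]

/-- Some conjugate of $v$ is either not a natural combination up to sign, or equals $m\alpha_i$,
where $m=1$ would make $v$ a root. In both cases the conjugated operator vanishes. -/
theorem eq_zero_of_notMem_range_root {hΨ : IsMinusculeUnion b Ψ} {z : Module.Basis Ψ ℚ V}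
    {X : Module.End ℚ V} {v : E} (hX : X ∈ lieSpace hΨ z) (hw : HasWeight z X v) (hv : v ≠ 0)
    (hr : v ∉ Set.range P.root) : X = 0 := by
  have key : ∀ w : List b.support, ((nWord hΨ z w : LinearMap.GeneralLinearGroup ℚ V) :
      Module.End ℚ V) * X * ((nWord hΨ z w)⁻¹ : LinearMap.GeneralLinearGroup ℚ V) = 0 → X = 0 := by
    intro w h
    rw [Units.mul_inv_eq_iff_eq_mul, zero_mul, Units.mul_right_eq_zero] at h
    exact h
  have hX' := fun w => conj_mem_lieSpace (nWord_mem hΨ z w) hX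
  have hw' := fun w => (movesWeights_nWord hΨ z w).hasWeight hw
  by_cases h : ∀ w : List b.support,
      IsNatComb b (wordRefl w v) ∨ IsNatComb b (-wordRefl w v)
  · obtain ⟨w, i, m, hm, h1⟩ := exists_word_of_forall_isNatComb hv h
    refine key w (eq_zero_of_hasWeight_nsmul (m := m) (i := i) ?_ (hX' w) (h1 ▸ hw' w))
    by_contra hm'
    obtain rfl : m = 1 := by omega
    rw [one_smul, ← LinearEquiv.eq_symm_apply] at h1
    exact hr (h1 ▸ wordRefl_symm_root_mem_range w i)
  · push Not at h
    obtain ⟨w, h1, h2⟩ := h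
    exact key w (eq_zero_of_not_isNatComb (hX' w) (hw' w) (by simpa using hv) h1 h2)

theorem exists_eq_smul_rootVec {hΨ : IsMinusculeUnion b Ψ} [Fintype Ψ] [DecidableEq Ψ]
    {N : Type*} [AddCommGroup N] (y : Module.Basis Ψ ℤ N) (z : Module.Basis Ψ ℚ V)
    (c : ∀ a, RootWord b a) {a : ι} {T : Module.End ℤ N} (hT : baseMap y z T ∈ lieSpace hΨ z)
    (hw : HasWeight z (baseMap y z T) (P.root a)) : ∃ m : ℤ, T = m • rootVec hΨ y c a := by
  set i := (c a).node with hi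
  set n := nWord hΨ y (c a).word with hn
  set T' := ((n⁻¹ : LinearMap.GeneralLinearGroup ℤ N) : Module.End ℤ N) * T *
    ((n⁻¹)⁻¹ : LinearMap.GeneralLinearGroup ℤ N) with hT'
  have h1 : baseMap y z T' = _ := baseMap_conj y z n⁻¹ T
  rw [map_inv, map_nWord] at h1
  have h2 : baseMap y z T' ∈ lieSpace hΨ z := by
    rw [h1]
    exact conj_mem_lieSpace (inv_mem (nWord_mem hΨ z _)) hT
  have h3 : HasWeight z (baseMap y z T') (P.root i) := by
    have := (movesWeights_nWord hΨ z (c a).word).inv.hasWeight hw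
    rw [← (c a).wordRefl_root, LinearEquiv.symm_apply_apply] at this
    rw [h1]
    exact this
  obtain ⟨q, hq⟩ := exists_eq_smul_eMap h2 h3
  -- If $(\mu,\alpha_i^\vee)=-1$ for some $\mu$, then $e_i$ has entry 1 from $z_\mu$ to
  -- $z_{\mu+\alpha_i}$, so the rational factor `q` is an entry of the integral `T'`. Otherwise
  -- $e_i=0$.
  have h4 : ∃ m : ℤ, T' = m • eMap hΨ y i := by
    by_cases hμ : ∃ μ : Ψ, P.coroot' i (μ : E) = -1
    · obtain ⟨μ, hμ⟩ := hμ
      refine ⟨y.repr (T' (y μ)) ⟨μ + P.root i, hΨ.add_mem i μ.2 hμ⟩, baseMap_injective y z ?_⟩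
      rw [map_zsmul, baseMap_eMap, hq, ← Int.cast_smul_eq_zsmul ℚ]
      congr 1
      rw [← repr_baseVec y z, ← baseMap_apply, hq, LinearMap.smul_apply, ← zExt_coe, eMap_zExt,
        if_pos hμ, map_smul, Finsupp.smul_apply, zExt, dif_pos (hΨ.add_mem i μ.2 hμ)]
      simp
    · refine ⟨0, baseMap_injective y z ?_⟩
      have h0 : eMap hΨ z i = 0 := z.ext fun μ => by
        rw [← zExt_coe, eMap_zExt, if_neg fun h => hμ ⟨μ, h⟩, LinearMap.zero_apply]
      rw [hq, h0, smul_zero, zero_smul, map_zero]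
  obtain ⟨m, hm⟩ := h4
  refine ⟨m, ?_⟩
  have h5 : T = (n : Module.End ℤ N) * T' * (n⁻¹ : LinearMap.GeneralLinearGroup ℤ N) := by
    rw [hT', inv_inv]
    simp only [mul_assoc, Units.mul_inv_cancel_left, Units.mul_inv, mul_one]
  rw [h5, hm, mul_smul_comm, smul_mul_assoc]
  rfl

theorem eq_zero_of_baseMap {hΨ : IsMinusculeUnion b Ψ} [Fintype Ψ] [DecidableEq Ψ]
    {N : Type*} [AddCommGroup N] (y : Module.Basis Ψ ℤ N) (z : Module.Basis Ψ ℚ V)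
    {v : E} {T : Module.End ℤ N} (hT : baseMap y z T ∈ lieSpace hΨ z)
    (hw : HasWeight z (baseMap y z T) v) (hv : v ≠ 0) (hr : v ∉ Set.range P.root) : T = 0 :=
  baseMap_injective y z (by rw [eq_zero_of_notMem_range_root hT hw hv hr, map_zero])

end Integrality

/-! ### Products and conjugates of root vectors over $R$. -/

section RootVectors

variable {ι E F : Type*} [AddCommGroup E] [Module ℚ E] [AddCommGroup F] [Module ℚ F]
  {P : RootPairing ι ℚ E F} {b : P.Base} {Ψ : Set E}
  {R M : Type*} [CommRing R] [AddCommGroup M] [Module R M]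

theorem coroot'_wordRefl (w : List b.support) {a i : ι}
    (h : P.root a = wordRefl w (P.root i)) (v : E) :
    P.coroot' a (wordRefl w v) = P.coroot' i v := by
  induction w generalizing a with
  | nil =>
    obtain rfl : a = i := P.root.injective h
    rfl
  | cons j w ih =>
    rw [wordRefl_cons_apply] at h ⊢
    rw [P.coroot'_reflection]
    refine ih ?_
    rw [RootPairing.root_reflectionPerm, h, RootPairing.reflection_same]

/-- For a simple root, $e_i$ maps vectors of $\alpha_i^\vee$-eigenvalue $-1$ to eigenvalue $1$;
conjugation by the word carries this to every root. -/
theorem diagMap_mul_rootVec (hΨ : IsMinusculeUnion b Ψ) {V : Type*} [AddCommGroup V] [Module ℚ V]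
    (z : Module.Basis Ψ ℚ V) (c : ∀ a, RootWord b a) (a : ι) :
    diagMap z (P.coroot' a) * rootVec hΨ z c a = rootVec hΨ z c a := by
  have h := movesWeights_nWord hΨ z (c a).word (P.coroot' a)
  have h1 : P.coroot' a ∘ₗ ((wordRefl (c a).word : E ≃ₗ[ℚ] E) : E →ₗ[ℚ] E) =
      P.coroot' (c a).node :=
    LinearMap.ext fun v => coroot'_wordRefl _ (c a).wordRefl_root.symm v
  have h2 : diagMap z (P.coroot' (c a).node) * eMap hΨ z (c a).node = eMap hΨ z (c a).node := by
    refine z.ext fun μ => ?_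
    rw [Module.End.mul_apply, ← zExt_coe, eMap_zExt]
    split_ifs with hμ
    · rw [diagMap_zExt, map_add, hμ, RootPairing.root_coroot'_eq_pairing,
        RootPairing.pairing_same]
      norm_num
    · simp
  rw [h1] at h
  rw [rootVec, ← mul_assoc, ← mul_assoc, h, mul_assoc _ (diagMap z _), h2]

theorem rootVec_mul_diagMap (hΨ : IsMinusculeUnion b Ψ) {V : Type*} [AddCommGroup V] [Module ℚ V]
    (z : Module.Basis Ψ ℚ V) (c : ∀ a, RootWord b a) (a : ι) :
    rootVec hΨ z c a * diagMap z (P.coroot' a) = -rootVec hΨ z c a := by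
  have h := hasWeight_rootVec hΨ z c a (P.coroot' a)
  rw [Ring.lie_def, diagMap_mul_rootVec, RootPairing.root_coroot'_eq_pairing,
    RootPairing.pairing_same, two_smul] at h
  have h' : rootVec hΨ z c a * diagMap z (P.coroot' a) = rootVec hΨ z c a -
      (rootVec hΨ z c a - rootVec hΨ z c a * diagMap z (P.coroot' a)) := by abel
  rw [h', h]
  abel

/-- Let $h$ be the diagonal operator of $\alpha^\vee$. The outer factors give $[h,X]=2X$, while the
weight $2\alpha+\alpha'$ gives $[h,X]=(4+(\alpha',\alpha^\vee))X$. -/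
theorem rootVec_mul_mul_eq_zero (hΨ : IsMinusculeUnion b Ψ) {V : Type*} [AddCommGroup V]
    [Module ℚ V] (z : Module.Basis Ψ ℚ V) (c : ∀ a, RootWord b a) {a a' : ι}
    (h : P.pairing a' a ≠ -2) : rootVec hΨ z c a * rootVec hΨ z c a' * rootVec hΨ z c a = 0 := by
  have h1 := (((hasWeight_rootVec hΨ z c a).mul (hasWeight_rootVec hΨ z c a')).mul
    (hasWeight_rootVec hΨ z c a)) (P.coroot' a)
  set X := rootVec hΨ z c a * rootVec hΨ z c a' * rootVec hΨ z c a with hX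
  have h2 : diagMap z (P.coroot' a) * X = X := by
    rw [hX, ← mul_assoc, ← mul_assoc, diagMap_mul_rootVec]
  have h3 : X * diagMap z (P.coroot' a) = -X := by
    rw [hX, mul_assoc, rootVec_mul_diagMap, mul_neg]
  rw [Ring.lie_def, h2, h3, map_add, map_add, RootPairing.root_coroot'_eq_pairing,
    RootPairing.root_coroot'_eq_pairing, RootPairing.pairing_same] at h1
  have h4 : (P.pairing a' a + 2) • X = 0 := by
    have : (P.pairing a' a + 2) • X = (2 + P.pairing a' a + 2) • X - (X - -X) := by module
    rw [this, h1, sub_self]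
  exact (smul_eq_zero.1 h4).resolve_left fun h5 => h (by linarith)

variable [Finite ι] [P.IsRootSystem] [P.IsCrystallographic]

/-- The hypotheses on `g` are checked over $\mathbb{Q}$, the factor is integral over $\mathbb{Z}$,
and base change yields the identity over $R$. -/
theorem exists_conj_rootVec_of_movesWeights {hΨ : IsMinusculeUnion b Ψ} [Fintype Ψ]
    [DecidableEq Ψ] {N V : Type*} [AddCommGroup N] [AddCommGroup V] [Module ℚ V]
    (y : Module.Basis Ψ ℤ N) (q : Module.Basis Ψ ℚ V) (z : Module.Basis Ψ R M)
    (c : ∀ a, RootWord b a) {g : LinearMap.GeneralLinearGroup ℤ N} {s : E ≃ₗ[ℚ] E}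
    (hg : Units.map (baseMap y q : Module.End ℤ N →* Module.End ℚ V) g ∈ chevalleyGroup hΨ q)
    (hs : MovesWeights q (Units.map (baseMap y q : Module.End ℤ N →* Module.End ℚ V) g) s)
    {a k : ι} (hk : P.root k = s (P.root a)) :
    ∃ m : ℤ, (Units.map (baseMap y z : Module.End ℤ N →* Module.End R M) g : Module.End R M) *
      rootVec hΨ z c a * ((Units.map (baseMap y z : Module.End ℤ N →* Module.End R M) g)⁻¹ :
        LinearMap.GeneralLinearGroup R M) = m • rootVec hΨ z c k := by
  have hq := baseMap_conj y q g (rootVec hΨ y c a)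
  have hz := baseMap_conj y z g (rootVec hΨ y c a)
  rw [baseMap_rootVec] at hq hz
  obtain ⟨m, hm⟩ := exists_eq_smul_rootVec (hΨ := hΨ) y q c (a := k)
    (T := (g : Module.End ℤ N) * rootVec hΨ y c a * (g⁻¹ : LinearMap.GeneralLinearGroup ℤ N))
    (by rw [hq]; exact conj_mem_lieSpace hg (rootVec_mem_lieSpace hΨ q c a))
    (by rw [hq, hk]; exact hs.hasWeight (hasWeight_rootVec hΨ q c a))
  exact ⟨m, by rw [← hz, hm, map_zsmul, baseMap_rootVec]⟩

theorem exists_conj_rootVec (hΨ : IsMinusculeUnion b Ψ) (z : Module.Basis Ψ R M)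
    (c : ∀ a, RootWord b a) (i : b.support) (a : ι) :
    ∃ m : ℤ, (nElt hΨ z i 1 : Module.End R M) * rootVec hΨ z c a *
      ((nElt hΨ z i 1)⁻¹ : LinearMap.GeneralLinearGroup R M) =
        m • rootVec hΨ z c (P.reflectionPerm i a) := by
  classical
  have := hΨ.finite
  cases nonempty_fintype Ψ
  let y : Module.Basis Ψ ℤ (Ψ →₀ ℤ) := Finsupp.basisSingleOne
  let q : Module.Basis Ψ ℚ (Ψ →₀ ℚ) := Finsupp.basisSingleOne
  rw [← map_nElt hΨ y z]
  refine exists_conj_rootVec_of_movesWeights y q z c (s := P.reflection i) ?_ ?_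
    (P.root_reflectionPerm i a)
  · rw [map_nElt]
    exact nElt_mem hΨ q i 1
  · rw [map_nElt]
    exact movesWeights_nElt hΨ q i

/-- The integer `m` is not shown to be $\pm1$; conjugating by the inverse as well is what turns
inclusions of root subgroups into equalities. -/
theorem exists_inv_conj_rootVec (hΨ : IsMinusculeUnion b Ψ) (z : Module.Basis Ψ R M)
    (c : ∀ a, RootWord b a) (i : b.support) (a : ι) :
    ∃ m : ℤ, ((nElt hΨ z i 1)⁻¹ : LinearMap.GeneralLinearGroup R M) * rootVec hΨ z c a *
      (((nElt hΨ z i 1)⁻¹)⁻¹ : LinearMap.GeneralLinearGroup R M) =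
        m • rootVec hΨ z c (P.reflectionPerm i a) := by
  classical
  have := hΨ.finite
  cases nonempty_fintype Ψ
  let y : Module.Basis Ψ ℤ (Ψ →₀ ℤ) := Finsupp.basisSingleOne
  let q : Module.Basis Ψ ℚ (Ψ →₀ ℚ) := Finsupp.basisSingleOne
  rw [← map_nElt hΨ y z, ← map_inv]
  refine exists_conj_rootVec_of_movesWeights y q z c (s := (P.reflection i).symm) ?_ ?_ ?_
  · rw [map_inv, map_nElt]
    exact inv_mem (nElt_mem hΨ q i 1)
  · rw [map_inv, map_nElt]
    exact (movesWeights_nElt hΨ q i).inv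
  · rw [LinearEquiv.eq_symm_apply, RootPairing.root_reflectionPerm, RootPairing.reflection_same]

theorem exists_lie_rootVec (hΨ : IsMinusculeUnion b Ψ) (z : Module.Basis Ψ R M)
    (c : ∀ a, RootWord b a) {a a' : ι} (h0 : P.root a + P.root a' ≠ 0) :
    rootVec hΨ z c a * rootVec hΨ z c a' - rootVec hΨ z c a' * rootVec hΨ z c a = 0 ∨
    ∃ (k : ι) (m : ℤ), P.root k = P.root a + P.root a' ∧
      rootVec hΨ z c a * rootVec hΨ z c a' - rootVec hΨ z c a' * rootVec hΨ z c a =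
        m • rootVec hΨ z c k := by
  classical
  have := hΨ.finite
  cases nonempty_fintype Ψ
  let y : Module.Basis Ψ ℤ (Ψ →₀ ℤ) := Finsupp.basisSingleOne
  let q : Module.Basis Ψ ℚ (Ψ →₀ ℚ) := Finsupp.basisSingleOne
  set T := rootVec hΨ y c a * rootVec hΨ y c a' - rootVec hΨ y c a' * rootVec hΨ y c a with hT
  have hq := congrArg (baseMap y q) hT
  have hz := congrArg (baseMap y z) hT
  simp only [map_sub, map_mul, baseMap_rootVec] at hq hz
  have h1 : baseMap y q T ∈ lieSpace hΨ q := by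
    rw [hq]; exact lie_rootVec_mem_lieSpace c a (rootVec_mem_lieSpace hΨ q c a')
  have h2 : HasWeight q (baseMap y q T) (P.root a + P.root a') := by
    rw [hq]; exact (hasWeight_rootVec hΨ q c a).lie (hasWeight_rootVec hΨ q c a')
  rw [← hz]
  by_cases hr : P.root a + P.root a' ∈ Set.range P.root
  · obtain ⟨k, hk⟩ := hr
    obtain ⟨m, hm⟩ := exists_eq_smul_rootVec y q c h1 (hk ▸ h2)
    exact Or.inr ⟨k, m, hk, by rw [hm, map_zsmul, baseMap_rootVec]⟩
  · exact Or.inl (by rw [eq_zero_of_baseMap y q h1 h2 h0 hr, map_zero])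

theorem exists_rootVec_mul_mul (hΨ : IsMinusculeUnion b Ψ) (z : Module.Basis Ψ R M)
    (c : ∀ a, RootWord b a) {a a' : ι} (h0 : P.root a + P.root a' + P.root a ≠ 0) :
    rootVec hΨ z c a * rootVec hΨ z c a' * rootVec hΨ z c a = 0 ∨
    ∃ (k : ι) (m : ℤ), P.root k = P.root a + P.root a' + P.root a ∧
      rootVec hΨ z c a * rootVec hΨ z c a' * rootVec hΨ z c a = m • rootVec hΨ z c k := by
  classical
  have := hΨ.finite
  cases nonempty_fintype Ψ
  let y : Module.Basis Ψ ℤ (Ψ →₀ ℤ) := Finsupp.basisSingleOne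
  let q : Module.Basis Ψ ℚ (Ψ →₀ ℚ) := Finsupp.basisSingleOne
  set T := rootVec hΨ y c a * rootVec hΨ y c a' * rootVec hΨ y c a with hT
  have hq := congrArg (baseMap y q) hT
  have hz := congrArg (baseMap y z) hT
  simp only [map_mul, baseMap_rootVec] at hq hz
  have h1 : baseMap y q T ∈ lieSpace hΨ q := by
    -- With $A^2=0$, $ABA=-\tfrac12[A,[A,B]]$.
    have h := (lieSpace hΨ q).smul_mem (-1 / 2) (lie_rootVec_mem_lieSpace c a
      (lie_rootVec_mem_lieSpace c a (rootVec_mem_lieSpace hΨ q c a')))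
    have hs := rootVec_mul_self hΨ q c a
    rw [hq]
    convert h using 1
    set A := rootVec hΨ q c a
    set B := rootVec hΨ q c a'
    have : A * (A * B - B * A) - (A * B - B * A) * A =
      A * A * B + B * (A * A) - (A * B * A + A * B * A) := by
        simp only [mul_sub, sub_mul, mul_assoc]
        abel
    rw [this, hs]
    simp only [zero_mul, mul_zero]
    module
  have h2 : HasWeight q (baseMap y q T) (P.root a + P.root a' + P.root a) := by
    rw [hq]
    exact ((hasWeight_rootVec hΨ q c a).mul (hasWeight_rootVec hΨ q c a')).mul
      (hasWeight_rootVec hΨ q c a)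
  rw [← hz]
  by_cases hr : P.root a + P.root a' + P.root a ∈ Set.range P.root
  · obtain ⟨k, hk⟩ := hr
    obtain ⟨m, hm⟩ := exists_eq_smul_rootVec y q c h1 (hk ▸ h2)
    exact Or.inr ⟨k, m, hk, by rw [hm, map_zsmul, baseMap_rootVec]⟩
  · exact Or.inl (by rw [eq_zero_of_baseMap y q h1 h2 h0 hr, map_zero])

-- A product can survive only if the corresponding pairing is $-2$, and both pairings equal $-2$
-- only for opposite roots.
omit [P.IsCrystallographic] in
theorem rootVec_mul_mul_eq_zero_or [P.IsReduced] (hΨ : IsMinusculeUnion b Ψ)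
    (z : Module.Basis Ψ R M) (c : ∀ a, RootWord b a) {a a' : ι} (h0 : P.root a ≠ -P.root a') :
    rootVec hΨ z c a * rootVec hΨ z c a' * rootVec hΨ z c a = 0 ∨
    rootVec hΨ z c a' * rootVec hΨ z c a * rootVec hΨ z c a' = 0 := by
  classical
  have := hΨ.finite
  cases nonempty_fintype Ψ
  let y : Module.Basis Ψ ℤ (Ψ →₀ ℤ) := Finsupp.basisSingleOne
  let q : Module.Basis Ψ ℚ (Ψ →₀ ℚ) := Finsupp.basisSingleOne
  have key : ∀ a a', P.pairing a' a ≠ -2 →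
      rootVec hΨ z c a * rootVec hΨ z c a' * rootVec hΨ z c a = 0 := by
    intro a a' h
    have h1 : rootVec hΨ y c a * rootVec hΨ y c a' * rootVec hΨ y c a = 0 := by
      refine baseMap_injective y q ?_
      rw [map_mul, map_mul, baseMap_rootVec, baseMap_rootVec, map_zero]
      exact rootVec_mul_mul_eq_zero hΨ q c h
    have h2 := congrArg (baseMap y z) h1
    rwa [map_mul, map_mul, baseMap_rootVec, baseMap_rootVec, map_zero] at h2
  by_cases h : P.pairing a' a = -2
  · refine Or.inr (key a' a fun h' => h0 ?_)
    exact (P.pairing_neg_two_neg_two_iff a a').1 ⟨h', h⟩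
  · exact Or.inl (key a a' h)

end RootVectors

/-! ### Commutators of two square-zero unipotents. -/

section Commutator

variable {R A : Type*} [CommRing R] [Ring A] [Algebra R A]

theorem commutator_unip_eq {a b : A} (ha : a * a = 0) (hb : b * b = 0) (hab : b * a * b = 0)
    (t u : R) : (1 + t • a) * (1 + u • b) * (1 - t • a) * (1 - u • b) =
      (1 + (t * u) • (a * b - b * a)) * (1 + (-(t * t * u)) • (a * b * a)) := by
  have ha' : ∀ x, a * (a * x) = 0 := fun x => by rw [← mul_assoc, ha, zero_mul]
  have h1 : b * (a * b) = 0 := by rw [← mul_assoc, hab]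
  have h2 : ∀ x, b * (a * (b * x)) = 0 := fun x => by
    rw [← mul_assoc a, ← mul_assoc b, h1, zero_mul]
  simp only [mul_add, add_mul, mul_sub, sub_mul, smul_sub, smul_add, one_mul, mul_one,
    smul_mul_assoc, mul_smul_comm, mul_assoc, ha, hb, ha', h1, h2, smul_zero, mul_zero, zero_mul]
  module

theorem commutator_unip_eq' {a b : A} (ha : a * a = 0) (hb : b * b = 0) (hab : a * b * a = 0)
    (t u : R) : (1 + t • a) * (1 + u • b) * (1 - t • a) * (1 - u • b) =
      (1 + (t * u) • (a * b - b * a)) * (1 + (t * u * u) • (b * a * b)) := by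
  have hb' : ∀ x, b * (b * x) = 0 := fun x => by rw [← mul_assoc, hb, zero_mul]
  have h1 : a * (b * a) = 0 := by rw [← mul_assoc, hab]
  have h2 : ∀ x, a * (b * (a * x)) = 0 := fun x => by
    rw [← mul_assoc b, ← mul_assoc a, h1, zero_mul]
  simp only [mul_add, add_mul, mul_sub, sub_mul, smul_sub, smul_add, one_mul, mul_one,
    smul_mul_assoc, mul_smul_comm, mul_assoc, ha, hb, hb', h1, h2, smul_zero, mul_zero, zero_mul]
  module

end Commutator

/-! ### Commutator relations and the structure of $U^+$ and $U_i^+$. -/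

section RootSubgroups

variable {ι E F : Type*} [AddCommGroup E] [Module ℚ E] [AddCommGroup F] [Module ℚ F]
  {P : RootPairing ι ℚ E F} {b : P.Base} {Ψ : Set E}
  {R M : Type*} [CommRing R] [AddCommGroup M] [Module R M]

theorem unip_mul_unip (e : Module.End R M) (he : e * e = 0) (t u : R) :
    unip e he t * unip e he u = unip e he (t + u) := by
  refine Units.ext ?_
  rw [Units.val_mul, val_unip, val_unip, val_unip]
  simp only [mul_add, add_mul, one_mul, mul_one, smul_mul_assoc, mul_smul_comm, he, smul_zero]
  module

/-- The root subgroup `X_α` as a subgroup. -/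
def rootSub (hΨ : IsMinusculeUnion b Ψ) (z : Module.Basis Ψ R M) (c : ∀ a, RootWord b a) (a : ι) :
    Subgroup (LinearMap.GeneralLinearGroup R M) where
  carrier := rootSubgroup hΨ z c a
  one_mem' := ⟨0, Units.ext (by simp [xRoot, val_unip])⟩
  mul_mem' := by
    rintro _ _ ⟨t, rfl⟩ ⟨u, rfl⟩
    exact ⟨t + u, (unip_mul_unip _ _ t u).symm⟩
  inv_mem' := by
    rintro _ ⟨t, rfl⟩
    exact ⟨-t, (unip_inv _ _ t).symm⟩

theorem xRoot_mem_rootSub (hΨ : IsMinusculeUnion b Ψ) (z : Module.Basis Ψ R M)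
    (c : ∀ a, RootWord b a) (a : ι) (t : R) : xRoot hΨ z c a t ∈ rootSub hΨ z c a :=
  ⟨t, rfl⟩

theorem conj_xRoot_mem {hΨ : IsMinusculeUnion b Ψ} {z : Module.Basis Ψ R M}
    {c : ∀ a, RootWord b a} {g : LinearMap.GeneralLinearGroup R M} {a k : ι} {m : ℤ}
    (h : (g : Module.End R M) * rootVec hΨ z c a *
      (g⁻¹ : LinearMap.GeneralLinearGroup R M) = m • rootVec hΨ z c k) (t : R) :
    g * xRoot hΨ z c a t * g⁻¹ ∈ rootSub hΨ z c k := by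
  refine ⟨t * m, Units.ext ?_⟩
  rw [xRoot, xRoot, Units.val_mul, Units.val_mul, val_unip, val_unip, mul_add, add_mul, mul_one,
    Units.mul_inv, mul_smul_comm, smul_mul_assoc, h, mul_smul, Int.cast_smul_eq_zsmul]

theorem rootSubgroup_subset_chevalleyGroup (hΨ : IsMinusculeUnion b Ψ) (z : Module.Basis Ψ R M)
    (c : ∀ a, RootWord b a) (a : ι) :
    rootSubgroup hΨ z c a ⊆ chevalleyGroup hΨ z := by
  rintro _ ⟨t, rfl⟩
  have hn := nWord_mem hΨ z (c a).word
  have h : xRoot hΨ z c a t = nWord hΨ z (c a).word * xSimple hΨ z (c a).node t *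
      (nWord hΨ z (c a).word)⁻¹ := by
    refine Units.ext ?_
    rw [xRoot, xSimple, Units.val_mul, Units.val_mul, val_unip, val_unip, mul_add, add_mul,
      mul_one, Units.mul_inv, mul_smul_comm, smul_mul_assoc]
    rfl
  rw [h]
  exact mul_mem (mul_mem hn (xSimple_mem hΨ z _ t)) (inv_mem hn)

theorem uPlus_eq_heightSubgroup (hΨ : IsMinusculeUnion b Ψ) (z : Module.Basis Ψ R M)
    (c : ∀ a, RootWord b a) (ht : ι → ℕ) :
    uPlus hΨ z c = heightSubgroup (rootSub hΨ z c) b.IsPos ht 0 := by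
  refine le_antisymm ((Subgroup.closure_le _).2 ?_) (iSup₂_le ?_)
  · rintro _ ⟨a, t, ha, rfl⟩
    exact mem_heightSubgroup ha (Nat.zero_le _) (xRoot_mem_rootSub hΨ z c a t)
  · rintro a ha _ ⟨t, rfl⟩
    exact Subgroup.subset_closure ⟨a, t, ha.1, rfl⟩

open Classical in
theorem uPlusMinus_eq_heightSubgroup (hΨ : IsMinusculeUnion b Ψ) (z : Module.Basis Ψ R M)
    (c : ∀ a, RootWord b a) (i : b.support) :
    uPlusMinus hΨ z c i = heightSubgroup (rootSub hΨ z c) b.IsPos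
      (fun a => if a = i then 0 else 1) 1 := by
  refine le_antisymm ((Subgroup.closure_le _).2 ?_) (iSup₂_le ?_)
  · simp only [Set.iUnion_subset_iff]
    rintro a ⟨ha, hai⟩ _ ⟨t, rfl⟩
    exact mem_heightSubgroup ha (by simp [hai]) (xRoot_mem_rootSub hΨ z c a t)
  · rintro a ⟨ha, hai⟩ _ ⟨t, rfl⟩
    refine Subgroup.subset_closure (Set.mem_iUnion₂.2 ⟨a, ⟨ha, ?_⟩, t, rfl⟩)
    rintro h
    simp [h] at hai

variable [Finite ι] [P.IsRootSystem] [P.IsCrystallographic]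

theorem conj_nElt_mem (hΨ : IsMinusculeUnion b Ψ) (z : Module.Basis Ψ R M)
    (c : ∀ a, RootWord b a) (i : b.support) {a : ι} {x : LinearMap.GeneralLinearGroup R M}
    (hx : x ∈ rootSub hΨ z c a) :
    nElt hΨ z i 1 * x * (nElt hΨ z i 1)⁻¹ ∈ rootSub hΨ z c (P.reflectionPerm i a) := by
  obtain ⟨t, rfl⟩ := hx
  obtain ⟨m, hm⟩ := exists_conj_rootVec hΨ z c i a
  exact conj_xRoot_mem hm t

theorem inv_conj_nElt_mem (hΨ : IsMinusculeUnion b Ψ) (z : Module.Basis Ψ R M)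
    (c : ∀ a, RootWord b a) (i : b.support) {a : ι} {x : LinearMap.GeneralLinearGroup R M}
    (hx : x ∈ rootSub hΨ z c a) :
    (nElt hΨ z i 1)⁻¹ * x * nElt hΨ z i 1 ∈ rootSub hΨ z c (P.reflectionPerm i a) := by
  obtain ⟨t, rfl⟩ := hx
  obtain ⟨m, hm⟩ := exists_inv_conj_rootVec hΨ z c i a
  have := conj_xRoot_mem hm t
  rwa [inv_inv] at this

theorem image_conj_nElt_rootSubgroup (hΨ : IsMinusculeUnion b Ψ) (z : Module.Basis Ψ R M)
    (c : ∀ a, RootWord b a) (i : b.support) (a : ι) :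
    (fun g => nElt hΨ z i 1 * g * (nElt hΨ z i 1)⁻¹) '' rootSubgroup hΨ z c a =
      rootSubgroup hΨ z c (P.reflectionPerm i a) := by
  refine Set.Subset.antisymm ?_ fun x hx => ⟨(nElt hΨ z i 1)⁻¹ * x * nElt hΨ z i 1, ?_, by group⟩
  · rintro _ ⟨x, hx, rfl⟩
    exact conj_nElt_mem hΨ z c i hx
  · have := inv_conj_nElt_mem hΨ z c i (a := P.reflectionPerm i a) hx
    rwa [RootPairing.reflectionPerm_self] at this

variable [P.IsReduced]

-- Otherwise $2\alpha=-\alpha'$ would be a root.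
omit [Finite ι] [P.IsRootSystem] [P.IsCrystallographic] in
theorem root_add_add_root_ne_zero (a a' : ι) : P.root a + P.root a' + P.root a ≠ 0 := by
  intro h
  have : IsAddTorsionFree E := .of_isTorsionFree ℚ E
  refine P.nsmul_notMem_range_root (n := 2) (i := a) ⟨negIdx P a', ?_⟩
  rw [root_negIdx, two_nsmul, neg_eq_iff_add_eq_zero, ← h]
  abel

/-- Chevalley's commutator relations. -/
theorem commutator_xRoot_mem (hΨ : IsMinusculeUnion b Ψ) (z : Module.Basis Ψ R M)
    (c : ∀ a, RootWord b a) {a a' : ι} (h0 : P.root a ≠ -P.root a')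
    (H : Subgroup (LinearMap.GeneralLinearGroup R M))
    (hH : ∀ k, P.root k = P.root a + P.root a' ∨ P.root k = P.root a + P.root a' + P.root a ∨
      P.root k = P.root a' + P.root a + P.root a' → rootSub hΨ z c k ≤ H) (t u : R) :
    ⁅xRoot hΨ z c a t, xRoot hΨ z c a' u⁆ ∈ H := by
  set A := rootVec hΨ z c a with hA
  set B := rootVec hΨ z c a' with hB
  have hAA : A * A = 0 := rootVec_mul_self hΨ z c a
  have hBB : B * B = 0 := rootVec_mul_self hΨ z c a'
  have key : ∀ (X : Module.End R M) (v : E),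
      (∀ k, P.root k = v → rootSub hΨ z c k ≤ H) →
      (X = 0 ∨ ∃ (k : ι) (m : ℤ), P.root k = v ∧ X = m • rootVec hΨ z c k) →
      ∀ s : R, ∃ g ∈ H, (g : Module.End R M) = 1 + s • X := by
    rintro X v hv (rfl | ⟨k, m, hk, rfl⟩) s
    · exact ⟨1, one_mem _, by simp⟩
    · refine ⟨xRoot hΨ z c k (s * m), hv k hk (xRoot_mem_rootSub hΨ z c k _), ?_⟩
      rw [xRoot, val_unip, mul_smul, Int.cast_smul_eq_zsmul]
  have hval : ((⁅xRoot hΨ z c a t, xRoot hΨ z c a' u⁆ :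
      LinearMap.GeneralLinearGroup R M) : Module.End R M) =
      (1 + t • A) * (1 + u • B) * (1 - t • A) * (1 - u • B) := rfl
  obtain ⟨g, hg, hg'⟩ := key (A * B - B * A) _ (fun k hk => hH k (Or.inl hk))
    (exists_lie_rootVec hΨ z c fun h => h0 (eq_neg_of_add_eq_zero_left h)) (t * u)
  rcases rootVec_mul_mul_eq_zero_or hΨ z c h0 with h | h
  · obtain ⟨g', hg₁, hg₂⟩ := key (B * A * B) _ (fun k hk => hH k (Or.inr (Or.inr hk)))
      (exists_rootVec_mul_mul hΨ z c (root_add_add_root_ne_zero a' a)) (t * u * u)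
    have : ⁅xRoot hΨ z c a t, xRoot hΨ z c a' u⁆ = g * g' := Units.ext (by
      rw [hval, Units.val_mul, hg', hg₂, commutator_unip_eq' hAA hBB h])
    rw [this]
    exact mul_mem hg hg₁
  · obtain ⟨g', hg₁, hg₂⟩ := key (A * B * A) _ (fun k hk => hH k (Or.inr (Or.inl hk)))
      (exists_rootVec_mul_mul hΨ z c (root_add_add_root_ne_zero a a')) (-(t * t * u))
    have : ⁅xRoot hΨ z c a t, xRoot hΨ z c a' u⁆ = g * g' := Units.ext (by
      rw [hval, Units.val_mul, hg', hg₂, commutator_unip_eq hAA hBB h])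
    rw [this]
    exact mul_mem hg hg₁

omit [Finite ι] [P.IsRootSystem] [P.IsCrystallographic] [P.IsReduced] in
theorem height_root_add_add_root {a a' k : ι} (h : P.root k = P.root a + P.root a' + P.root a) :
    b.height k = 2 * b.height a + b.height a' := by
  have := b.height_add_zsmul (i := a') (j := a) (k := k) (z := 2) (by
    rw [h, two_zsmul]
    abel)
  rw [this, smul_eq_mul, add_comm]

omit [Finite ι] [P.IsRootSystem] [P.IsCrystallographic] [P.IsReduced] in
theorem root_ne_neg_of_isPos {a a' : ι} (ha : b.IsPos a) (ha' : b.IsPos a') :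
    P.root a ≠ -P.root a' := by
  intro h
  rw [← root_negIdx] at h
  have h1 := P.root.injective h
  have h2 : b.height (negIdx P a') = -b.height a' := b.height_reflectionPerm_self a'
  rw [RootPairing.Base.isPos_iff] at ha ha'
  rw [h1, h2] at ha
  omega

theorem commutator_mem_heightSubgroup_of_isPos (hΨ : IsMinusculeUnion b Ψ)
    (z : Module.Basis Ψ R M) (c : ∀ a, RootWord b a) (ht : ι → ℕ) {h : ℕ} {a a' : ι}
    (ha : b.IsPos a) (ha' : b.IsPos a')
    (hht : ∀ k, b.height a < b.height k → b.height a' < b.height k → h ≤ ht k)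
    {x y : LinearMap.GeneralLinearGroup R M} (hx : x ∈ rootSub hΨ z c a)
    (hy : y ∈ rootSub hΨ z c a') :
    ⁅x, y⁆ ∈ heightSubgroup (rootSub hΨ z c) b.IsPos ht h := by
  obtain ⟨t, rfl⟩ := hx
  obtain ⟨u, rfl⟩ := hy
  refine commutator_xRoot_mem hΨ z c (root_ne_neg_of_isPos ha ha') _ (fun k hk => ?_) t u
  rw [RootPairing.Base.isPos_iff] at ha ha'
  have h1 : b.height a < b.height k ∧ b.height a' < b.height k := by
    rcases hk with hk | hk | hk
    · rw [b.height_add hk]; omega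
    · rw [height_root_add_add_root hk]; omega
    · rw [height_root_add_add_root hk]; omega
  intro x hx
  exact mem_heightSubgroup (b.isPos_iff.2 (by omega)) (hht k h1.1 h1.2) hx

theorem uPlus_eq_prod (hΨ : IsMinusculeUnion b Ψ) (z : Module.Basis Ψ R M)
    (c : ∀ a, RootWord b a) (l : List ι) (hl : ∀ a, a ∈ l ↔ b.IsPos a) :
    (uPlus hΨ z c : Set (LinearMap.GeneralLinearGroup R M)) =
      (l.map (rootSubgroup hΨ z c)).prod := by
  rw [uPlus_eq_heightSubgroup hΨ z c fun a => (b.height a).toNat]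
  refine heightSubgroup_eq_prod (fun a a' ha ha' x hx y hy => ?_) l hl
  refine commutator_mem_heightSubgroup_of_isPos hΨ z c _ ha ha' (fun k _ h => ?_) hx hy
  rw [RootPairing.Base.isPos_iff] at ha'
  omega

omit [Finite ι] [P.IsRootSystem] [P.IsCrystallographic] [P.IsReduced] in
theorem uPlusMinus_le_uPlus (hΨ : IsMinusculeUnion b Ψ) (z : Module.Basis Ψ R M)
    (c : ∀ a, RootWord b a) (i : b.support) : uPlusMinus hΨ z c i ≤ uPlus hΨ z c := by
  classical
  rw [uPlusMinus_eq_heightSubgroup, uPlus_eq_heightSubgroup]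
  exact heightSubgroup_anti (Nat.zero_le _)

theorem uPlusMinus_normal (hΨ : IsMinusculeUnion b Ψ) (z : Module.Basis Ψ R M)
    (c : ∀ a, RootWord b a) (i : b.support) :
    ((uPlusMinus hΨ z c i).subgroupOf (uPlus hΨ z c)).Normal := by
  classical
  refine ⟨fun v hv u => ?_⟩
  rw [Subgroup.mem_subgroupOf] at hv ⊢
  have hu := (uPlus_eq_heightSubgroup hΨ z c fun a => if a = i then 0 else 1).le u.2
  rw [uPlusMinus_eq_heightSubgroup] at hv ⊢
  refine conj_mem_heightSubgroup (fun a a' ha ha' _ x hx y hy => ?_) hu hv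
  refine commutator_mem_heightSubgroup_of_isPos hΨ z c _ ha ha' (fun k hk _ => ?_) hx hy
  -- The new root is higher than a positive root, so its height is at least 2, whereas $\alpha_i$
  -- has height 1.
  have : k ≠ i := by
    rintro rfl
    rw [RootPairing.Base.height_one_of_mem_support i.2] at hk
    rw [RootPairing.Base.isPos_iff] at ha
    omega
  simp [this]

theorem uPlus_eq_rootSubgroup_mul (hΨ : IsMinusculeUnion b Ψ) (z : Module.Basis Ψ R M)
    (c : ∀ a, RootWord b a) (i : b.support) :
    (uPlus hΨ z c : Set (LinearMap.GeneralLinearGroup R M)) =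
      rootSubgroup hΨ z c i *
        (uPlusMinus hΨ z c i : Set (LinearMap.GeneralLinearGroup R M)) := by
  classical
  cases nonempty_fintype ι
  -- The order of the product is free, so $\alpha_i$ is put first.
  set l := (Finset.univ.filter fun a => b.IsPos a ∧ a ≠ i).toList with hl
  have hl' : ∀ a, a ∈ (i : ι) :: l ↔ b.IsPos a := by
    intro a
    have := RootPairing.Base.isPos_of_mem_support i.2
    by_cases h : a = i
    · simp [h, this]
    · simp [hl, h]
  refine Set.Subset.antisymm (fun x hx => ?_) ?_
  · rw [uPlus_eq_prod hΨ z c _ hl', List.map_cons, List.prod_cons] at hx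
    obtain ⟨y, hy, w, hw, rfl⟩ := hx
    refine ⟨y, hy, w, ?_, rfl⟩
    have := prod_subset_heightSubgroup (X := rootSub hΨ z c) (p := fun a => b.IsPos a ∧ a ≠ i)
      (ht := fun _ => 0) (l := l) (by simp [hl]) hw
    refine (iSup₂_le fun a ha x hx => ?_ : heightSubgroup (rootSub hΨ z c)
      (fun a => b.IsPos a ∧ a ≠ i) (fun _ => 0) 0 ≤ uPlusMinus hΨ z c i) this
    exact Subgroup.subset_closure (Set.mem_iUnion₂.2 ⟨a, ha.1, hx⟩)
  · rintro _ ⟨x, ⟨t, rfl⟩, y, hy, rfl⟩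
    exact mul_mem (Subgroup.subset_closure
      ⟨i, t, RootPairing.Base.isPos_of_mem_support i.2, rfl⟩) (uPlusMinus_le_uPlus hΨ z c i hy)

-- $s_i$ permutes the positive roots other than $\alpha_i$; $s_i\alpha=\alpha_i$ would give
-- $\alpha=-\alpha_i$.
omit [P.IsRootSystem] in
theorem isPos_reflectionPerm (i : b.support) {a : ι} (ha : b.IsPos a) (hai : a ≠ i) :
    b.IsPos (P.reflectionPerm i a) ∧ P.reflectionPerm i a ≠ i := by
  have h := ha.reflectionPerm i.2 hai
  refine ⟨h, fun h' => ?_⟩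
  have h1 : a = negIdx P i := by
    rw [negIdx]
    conv_rhs => enter [2]; rw [← h']
    rw [RootPairing.reflectionPerm_self]
  refine root_ne_neg_of_isPos ha (RootPairing.Base.isPos_of_mem_support i.2) ?_
  rw [h1, root_negIdx]

theorem image_conj_nElt_uPlusMinus (hΨ : IsMinusculeUnion b Ψ) (z : Module.Basis Ψ R M)
    (c : ∀ a, RootWord b a) (i : b.support) :
    (fun g => nElt hΨ z i 1 * g * (nElt hΨ z i 1)⁻¹) ''
      (uPlusMinus hΨ z c i : Set (LinearMap.GeneralLinearGroup R M)) = uPlusMinus hΨ z c i := by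
  have key : ∀ n : LinearMap.GeneralLinearGroup R M,
      (∀ a, ∀ x ∈ rootSub hΨ z c a, n * x * n⁻¹ ∈ rootSub hΨ z c (P.reflectionPerm i a)) →
      uPlusMinus hΨ z c i ≤ (uPlusMinus hΨ z c i).comap (MulAut.conj n).toMonoidHom := by
    intro n hn
    refine (Subgroup.closure_le _).2 (Set.iUnion₂_subset fun a ha x hx => ?_)
    exact Subgroup.subset_closure (Set.mem_iUnion₂.2
      ⟨P.reflectionPerm i a, isPos_reflectionPerm i ha.1 ha.2, hn a x hx⟩)
  refine Set.Subset.antisymm ?_ fun x hx => ⟨(nElt hΨ z i 1)⁻¹ * x * nElt hΨ z i 1, ?_, by group⟩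
  · rintro _ ⟨x, hx, rfl⟩
    exact key _ (fun a x hx => conj_nElt_mem hΨ z c i hx) hx
  · have := key (nElt hΨ z i 1)⁻¹
      (fun a x hx => by rw [inv_inv]; exact inv_conj_nElt_mem hΨ z c i hx) hx
    simpa using this

end RootSubgroups

end

end MinusculeChevalley

theorem corollary3p3 {ι E F : Type*} [Finite ι]
    [AddCommGroup E] [Module ℚ E] [AddCommGroup F] [Module ℚ F]
    (P : RootPairing ι ℚ E F) [P.IsRootSystem] [P.IsCrystallographic] [P.IsReduced]
    [P.IsIrreducible] (b : P.Base)
    (Ψ : Set E) (hΨ : MinusculeChevalley.IsMinusculeUnion b Ψ)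
    {R M : Type*} [CommRing R] [AddCommGroup M] [Module R M] (z : Module.Basis Ψ R M)
    (c : ∀ a, MinusculeChevalley.RootWord b a) :
    (∀ a, MinusculeChevalley.rootSubgroup hΨ z c a ⊆ MinusculeChevalley.chevalleyGroup hΨ z) ∧
    (∀ l : List ι, l.Nodup → (∀ a, a ∈ l ↔ b.IsPos a) →
      (MinusculeChevalley.uPlus hΨ z c : Set (LinearMap.GeneralLinearGroup R M)) =
        (l.map (MinusculeChevalley.rootSubgroup hΨ z c)).prod) ∧
    ∀ i : b.support,
      MinusculeChevalley.uPlusMinus hΨ z c i ≤ MinusculeChevalley.uPlus hΨ z c ∧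
      ((MinusculeChevalley.uPlusMinus hΨ z c i).subgroupOf
        (MinusculeChevalley.uPlus hΨ z c)).Normal ∧
      (MinusculeChevalley.uPlus hΨ z c : Set (LinearMap.GeneralLinearGroup R M)) =
        MinusculeChevalley.rootSubgroup hΨ z c i *
          (MinusculeChevalley.uPlusMinus hΨ z c i : Set (LinearMap.GeneralLinearGroup R M)) ∧
      (fun g => MinusculeChevalley.nElt hΨ z i 1 * g * (MinusculeChevalley.nElt hΨ z i 1)⁻¹) ''
          MinusculeChevalley.rootSubgroup hΨ z c i =
        MinusculeChevalley.rootSubgroup hΨ z c (MinusculeChevalley.negIdx P i) ∧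
      (fun g => MinusculeChevalley.nElt hΨ z i 1 * g * (MinusculeChevalley.nElt hΨ z i 1)⁻¹) ''
          (MinusculeChevalley.uPlusMinus hΨ z c i : Set (LinearMap.GeneralLinearGroup R M)) =
        (MinusculeChevalley.uPlusMinus hΨ z c i : Set (LinearMap.GeneralLinearGroup R M)) := by
  exact ⟨MinusculeChevalley.rootSubgroup_subset_chevalleyGroup hΨ z c,
    fun l _ hl => MinusculeChevalley.uPlus_eq_prod hΨ z c l hl,
    fun i => ⟨MinusculeChevalley.uPlusMinus_le_uPlus hΨ z c i,
      MinusculeChevalley.uPlusMinus_normal hΨ z c i,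
      MinusculeChevalley.uPlus_eq_rootSubgroup_mul hΨ z c i,
      -- `negIdx P i` is by definition `P.reflectionPerm i i`.
      MinusculeChevalley.image_conj_nElt_rootSubgroup hΨ z c i i,
      MinusculeChevalley.image_conj_nElt_uPlusMinus hΨ z c i⟩⟩
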